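/- **Setting.** Fix $p\in\mathbb N$, $V=\{1,\dots,p\}$ and $\lambda>0$. For a positive definite $p\times p$ matrix $\Sigma$, distinct $j,k\in V$ and $S\subseteq V\setminus\{j,k\}$, let $\rho_{j,k|S}(\Sigma)$ be the partial correlation of $X_j,X_k$ given $X_S$ for $X\sim\mathcal N(0,\Sigma)$, i.e. $\rho_{j,k|S}=M_{jk}/\sqrt{M_{jj}M_{kk}}$ with $M=\Sigma-\Sigma_{V,S}\Sigma_{S,S}^{-1}\Sigma_{S,V}$, and let $\Omega_\lambda(\Sigma)=\{(j,k,S):|\rho_{j,k|S}(\Sigma)|\le\lambda\}$; $\Omega_0(\Sigma)$ is the set of conditional independence (CI) relations $X_j\perp X_k\mid X_S$ of $\mathcal N(0,\Sigma)$. A DAG $G$ on $V$ with $|G|$ edges is *Markov* with respect to a set $R$ of triples $(j,k,S)$ if $(j,k,S)\in R$ whenever $j$ and $k$ are d-separated by $S$ in $G$. $\mathcal M(G)$ is the Markov equivalence class of $G$, i.e. the set of all DAGs on $V$ with the same d-separations as $G$. The pair $(G^*,\Sigma)$ satisfies the *$\lambda$-strong SMR (sparsest Markov representation) assumption* if $G^*$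 is Markov with respect to $\Omega_\lambda(\Sigma)$ and $|G|>|G^*|$ for every DAG $G\notin\mathcal M(G^*)$ that is Markov with respect to $\Omega_\lambda(\Sigma)$. **SP algorithm.** Given a set $R$ of CI relations and a permutation $\pi$ of $V$, let $G_\pi$ be the DAG which for $i<m$ has the edge $\pi(i)\to\pi(m)$ if and only if $(\pi(i),\pi(m),\{\pi(1),\dots,\pi(m-1)\}\setminus\{\pi(i)\})\notin R$. The SP (sparsest permutation) algorithm outputs the set of all $G_\pi$ whose number of edges is minimal among all permutations. **Tests.** Let $X^{(1)},\dots,X^{(n)}$ be i.i.d. from $\mathcal N(0,\Sigma)$. A family of partial-correlation tests $\phi_n=(\phi_{n,j,k,S})$ assigns to each triple a $\{0,1\}$-valued measurable function of the sample partial correlations (those computed from $\widehat\Sigma=\frac1n\sum_i X^{(i)}X^{(i)T}$), the value $0$ meaning that $H_0:\rho_{j,k|S}=0$ is retained and $1$ that it is rejected in favour of $H_1:\rho_{j,k|S}\neq0$. The SP algorithm based on $\phi_n$ is run on $R=\{(j,k,S):\phi_{n,j,k,S}=0\}$. **Theorem.** For every $p$ and every $\lambda>0$ there is a sequence $(\phi_n)_n$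 of families of partial-correlation tests, not depending on $(G^*,\Sigma)$, such that each test is consistent (for each fixed positive definite $\Sigma$ the probability of a type I error, if $\rho_{j,k|S}(\Sigma)=0$, or of a type II error, if $\rho_{j,k|S}(\Sigma)\ne0$, tends to $0$ as $n\to\infty$), and such that the SP algorithm based on $\phi_n$ is uniformly consistent: $$\lim_{n\to\infty}\ \sup_{(G^*,\Sigma)}\ \mathbb P_{\Sigma}^{\,n}\bigl(\text{the output of the SP algorithm based on }\phi_n\text{ is not }\mathcal M(G^*)\bigr)=0,$$ where the supremum is over all pairs of a DAG $G^*$ on $V$ and a positive definite $\Sigma$ such that $\mathcal N(0,\Sigma)$ is Markov with respect to $G^*$ (that is, $G^*$ is Markov with respect to $\Omega_0(\Sigma)$) and $(G^*,\Sigma)$ satisfies the $\lambda$-strong SMR assumption. -/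

import Mathlib

open MeasureTheory ProbabilityTheory Filter Topology

namespace SP

/-- A directed acyclic graph on the vertex set `Fin p`. -/
structure DAG (p : ℕ) extends Digraph (Fin p) where
  acyclic : ∀ v, ¬ Relation.TransGen Adj v v

namespace DAG

variable {p : ℕ}

/-- The number of edges `|G|`. -/
noncomputable def numEdges (G : DAG p) : ℕ :=
  {e : Fin p × Fin p | G.Adj e.1 e.2}.ncard

/-- `l` is an undirected path: its vertices are distinct, consecutive ones are adjacent. -/
def IsPath (G : DAG p) (l : List (Fin p)) : Prop :=
  l.Nodup ∧ l.IsChain (fun a b => G.Adj a b ∨ G.Adj b a)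

/-- `b` lies in `S` or is an ancestor of some node in `S`. -/
def IsAncestorOf (G : DAG p) (b : Fin p) (S : Finset (Fin p)) : Prop :=
  ∃ d ∈ S, Relation.ReflTransGen G.Adj b d

/-- `l` is d-connecting given `S`: every collider on `l` is in `S` or is an ancestor of a node in
`S`, and no (inner) non-collider is in `S`. -/
def IsActive (G : DAG p) (S : Finset (Fin p)) (l : List (Fin p)) : Prop :=
  ∀ a b c, [a, b, c] <:+: l →
    (G.Adj a b ∧ G.Adj c b → G.IsAncestorOf b S) ∧
    (¬ (G.Adj a b ∧ G.Adj c b) → b ∉ S)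

/-- `j` and `k` are d-separated given `S` (used for `j ≠ k` and `S ⊆ V \ {j, k}`). -/
def DSep (G : DAG p) (j k : Fin p) (S : Finset (Fin p)) : Prop :=
  ¬ ∃ l : List (Fin p), l.head? = some j ∧ l.getLast? = some k ∧ G.IsPath l ∧ G.IsActive S l

end DAG

variable {p : ℕ}

/-- `(j, k, S)` is a triple as in a conditional independence statement `j ⊥ k | S`. -/
def IsTriple (j k : Fin p) (S : Finset (Fin p)) : Prop :=
  j ≠ k ∧ j ∉ S ∧ k ∉ S

/-- The (global) Markov assumption with respect to a set `R` of conditional independence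
relations. -/
def IsMarkov (G : DAG p) (R : Fin p → Fin p → Finset (Fin p) → Prop) : Prop :=
  ∀ j k S, IsTriple j k S → G.DSep j k S → R j k S

/-- Markov equivalence: the same d-separation relations. -/
def MarkovEquiv (G H : DAG p) : Prop :=
  ∀ j k S, IsTriple j k S → (G.DSep j k S ↔ H.DSep j k S)

/-- The Markov equivalence class `M(G)`. -/
def markovClass (G : DAG p) : Set (DAG p) := {H | MarkovEquiv H G}

/-- The sparsest Markov representation assumption with respect to a set `R` of conditional
independence relations. -/
def IsSMR (G : DAG p) (R : Fin p → Fin p → Finset (Fin p) → Prop) : Prop :=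
  IsMarkov G R ∧ ∀ H : DAG p, IsMarkov H R → H ∉ markovClass G → G.numEdges < H.numEdges

/-- The matrix `A - A_{V,S} (A_{S,S})⁻¹ A_{S,V}` of partial covariances given `S`. -/
noncomputable def partialCov (A : Matrix (Fin p) (Fin p) ℝ) (S : Finset (Fin p)) :
    Matrix (Fin p) (Fin p) ℝ :=
  A - A.submatrix id (fun s : S => (s : Fin p)) *
      (A.submatrix (fun s : S => (s : Fin p)) (fun s : S => (s : Fin p)))⁻¹ *
      A.submatrix (fun s : S => (s : Fin p)) id

/-- The partial correlation `ρ_{j,k|S}` computed from a covariance matrix `A`. -/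
noncomputable def partialCorr (A : Matrix (Fin p) (Fin p) ℝ) (j k : Fin p)
    (S : Finset (Fin p)) : ℝ :=
  partialCov A S j k / Real.sqrt (partialCov A S j j * partialCov A S k k)

/-- The relations `Ω_lam = {(j, k, S) : |ρ_{j,k|S}| ≤ lam}`. For a Gaussian distribution, `Ω_0`
consists of its conditional independence relations. -/
def Omega (A : Matrix (Fin p) (Fin p) ℝ) (lam : ℝ) (j k : Fin p) (S : Finset (Fin p)) : Prop :=
  |partialCorr A j k S| ≤ lam

/-- The `lam`-strong SMR assumption for `N(0, A)` with respect to `G`. -/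
def IsStrongSMR (lam : ℝ) (G : DAG p) (A : Matrix (Fin p) (Fin p) ℝ) : Prop :=
  IsSMR G (Omega A lam)

/-- The DAG `G_π` built from a set `R` of conditional independence relations: for `i < m` there is
an edge from `π i` to `π m` unless `R` contains `(π i, π m, {π 1, …, π (m - 1)} \ {π i})`. -/
def permDAG (R : Fin p → Fin p → Finset (Fin p) → Prop) (π : Equiv.Perm (Fin p)) : DAG p where
  Adj u v := ∃ i m : Fin p, i < m ∧ π i = u ∧ π m = v ∧
    ¬ R (π i) (π m) (((Finset.univ.filter (· < m)).image π).erase (π i))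
  acyclic := by
    intro v hv
    have key : ∀ a b, Relation.TransGen (fun u v => ∃ i m : Fin p, i < m ∧ π i = u ∧ π m = v ∧
        ¬ R (π i) (π m) (((Finset.univ.filter (· < m)).image π).erase (π i))) a b →
        π.symm a < π.symm b := by
      intro a b h
      induction h with
      | single h =>
        obtain ⟨i, m, him, rfl, rfl, -⟩ := h
        simpa using him
      | tail _ h ih =>
        obtain ⟨i, m, him, rfl, rfl, -⟩ := h
        exact ih.trans (by simpa using him)
    exact lt_irrefl _ (key v v hv)

/-- The output of the SP algorithm on a set `R` of conditional independence relations: all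
`G_π` with the smallest number of edges amongst all permutations. -/
def spOutput (R : Fin p → Fin p → Finset (Fin p) → Prop) : Set (DAG p) :=
  {G | ∃ π, G = permDAG R π ∧ ∀ σ, (permDAG R π).numEdges ≤ (permDAG R σ).numEdges}

/-- `n` observations of the random vector `(X_1, …, X_p)`. -/
abbrev Sample (n p : ℕ) := Fin n → EuclideanSpace ℝ (Fin p)

/-- The law of `n` i.i.d. observations from `N(0, A)`. -/
noncomputable def sampleLaw (n : ℕ) (A : Matrix (Fin p) (Fin p) ℝ) : Measure (Sample n p) :=
  Measure.pi fun _ => multivariateGaussian 0 A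

/-- The sample covariance matrix `(1/n) ∑ i, X⁽ⁱ⁾ X⁽ⁱ⁾ᵀ`. -/
noncomputable def sampleCov {n : ℕ} (x : Sample n p) : Matrix (Fin p) (Fin p) ℝ :=
  Matrix.of fun a b => (n : ℝ)⁻¹ * ∑ i, x i a * x i b

/-- Tests at sample size `n`, one for every triple `(j, k, S)`; `false` means that the hypothesis
`ρ_{j,k|S} = 0` is retained, `true` that it is rejected. -/
abbrev TestFamily (n p : ℕ) := Fin p → Fin p → Finset (Fin p) → Sample n p → Bool

/-- Each test of the family is a measurable function of the sample partial correlations. -/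
def IsPartialCorrTest {n : ℕ} (φ : TestFamily n p) : Prop :=
  ∀ j k S, ∃ ψ : (Fin p → Fin p → Finset (Fin p) → ℝ) → Bool, Measurable ψ ∧
    ∀ x, φ j k S x = ψ (partialCorr (sampleCov x))

/-- The tests of `ρ_{j,k|S} = 0` against `ρ_{j,k|S} ≠ 0` are consistent: at every nondegenerate
Gaussian distribution, the probability of a type I or type II error tends to `0`. -/
def IsConsistentTest (φ : (n : ℕ) → TestFamily n p) : Prop :=
  ∀ j k S, IsTriple j k S → ∀ A : Matrix (Fin p) (Fin p) ℝ, A.PosDef →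
    (partialCorr A j k S = 0 →
      Tendsto (fun n => sampleLaw n A {x | φ n j k S x = true}) atTop (𝓝 0)) ∧
    (partialCorr A j k S ≠ 0 →
      Tendsto (fun n => sampleLaw n A {x | φ n j k S x = false}) atTop (𝓝 0))

/-- The conditional independence relations inferred from the sample `x`. -/
def inferredCI {n : ℕ} (φ : TestFamily n p) (x : Sample n p) (j k : Fin p)
    (S : Finset (Fin p)) : Prop :=
  φ j k S x = false

end SP

/-! ### d-separation, topological orders and the DAGs `permDAG R π`. -/

namespace SP

namespace DAG

variable {p : ℕ}

/-! Uniformity comes from a pivotal quantity. The whitened sample `A^{-1/2} X` has the same law for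
every positive definite `A`, and by Chebyshev its sample covariance is within `n^{-1/4}` of the
identity with probability tending to one. On this event the quadratic form of `sampleCov x`
approximates that of `A` with small relative error. Partial variances are minima of the form, so
they inherit the relative error, and every partial correlation is off by at most `2 n^{-1/4}`,
however close to singular `A` is (`abs_partialCorr_sub_le`).

The combinatorial core is `IsPermMarkov.spOutput_eq`: SP returns the class of `G` on any set of
relations inside `Ω_lam` whose permutation DAGs are all Markov and for which some permutation DAG
has at most `|G|` edges. The true relations `Ω_0` have these properties, by the global Markov
property of a Gaussian structural equation model (`partialCov_eq_zero_of_dsep`). A thresholded set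
of sample relations may violate the Markov condition, and `regularize` then replaces it by a
permutation Markov subset of `{|ρ̂| ≤ lam/2}` with the sparsest outcome. On the good event `Ω_0`
competes in this minimisation and `{|ρ̂| ≤ lam/2}` lies in `Ω_lam`, so the replacement has the
required properties.

For fixed `A`, thresholding at `2 n^{-1/4}` eventually recovers `Ω_0` exactly on the good event. The
replacement is then idle, whence consistency of each test. -/

@[ext]
theorem ext_adj {G H : DAG p} (h : ∀ u v, G.Adj u v ↔ H.Adj u v) : G = H := by
  obtain ⟨⟨A⟩, hA⟩ := G
  obtain ⟨⟨B⟩, hB⟩ := H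
  have : A = B := by
    funext u v
    exact propext (h u v)
  subst this
  rfl

theorem not_adj_symm (G : DAG p) {u v : Fin p} (h : G.Adj u v) : ¬ G.Adj v u :=
  fun h' => G.acyclic u ((Relation.TransGen.single h).tail h')

theorem adj_ne (G : DAG p) {u v : Fin p} (h : G.Adj u v) : u ≠ v := by
  rintro rfl
  exact G.not_adj_symm h h

/-- Every DAG has a topological ordering. -/
theorem exists_topological (G : DAG p) :
    ∃ π : Equiv.Perm (Fin p), ∀ u v, G.Adj u v → π.symm u < π.symm v := by
  classical
  -- The number of proper ancestors strictly increases along an edge: the tail is an ancestor of the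
  -- head but not of itself. Sorting by it gives the order.
  let f : Fin p → ℕ := fun v => (Finset.univ.filter fun u => Relation.TransGen G.Adj u v).card
  have hf : ∀ u v, G.Adj u v → f u < f v := by
    intro u v huv
    refine Finset.card_lt_card ⟨fun w hw => ?_, fun hsub => ?_⟩
    · simp only [Finset.mem_filter, Finset.mem_univ, true_and] at hw ⊢
      exact hw.tail huv
    · have : u ∈ Finset.univ.filter fun w => Relation.TransGen G.Adj w u :=
        hsub (by simpa using Relation.TransGen.single huv)
      exact G.acyclic u (by simpa using this)
  refine ⟨Tuple.sort f, fun u v huv => ?_⟩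
  by_contra! hle
  have := Tuple.monotone_sort f hle
  simp only [Function.comp_apply, Equiv.apply_symm_apply] at this
  exact absurd (hf u v huv) (by omega)

theorem isActive_reverse {G : DAG p} {S : Finset (Fin p)} {l : List (Fin p)}
    (h : G.IsActive S l) : G.IsActive S l.reverse := by
  intro a b c habc
  have h1 : [c, b, a] <:+: l := by
    rw [← List.reverse_infix]
    simpa using habc
  obtain ⟨h2, h3⟩ := h c b a h1
  exact ⟨fun h => h2 h.symm, fun h => h3 fun h' => h h'.symm⟩

theorem isPath_reverse {G : DAG p} {l : List (Fin p)} (h : G.IsPath l) : G.IsPath l.reverse := by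
  refine ⟨List.nodup_reverse.2 h.1, ?_⟩
  rw [List.isChain_reverse]
  exact h.2.imp fun a b hab => hab.symm

theorem DSep.symm {G : DAG p} {j k : Fin p} {S : Finset (Fin p)} (h : G.DSep j k S) :
    G.DSep k j S := by
  rintro ⟨l, hj, hk, hl, ha⟩
  exact h ⟨l.reverse, by simpa using hk, by simpa using hj, isPath_reverse hl,
    isActive_reverse ha⟩

theorem IsActive.tail {G : DAG p} {S : Finset (Fin p)} {a : Fin p} {l : List (Fin p)}
    (h : G.IsActive S (a :: l)) : G.IsActive S l :=
  fun x y z hxyz => h x y z (hxyz.trans (List.suffix_cons a l).isInfix)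

theorem IsActive.cons {G : DAG p} {S : Finset (Fin p)} {a b : Fin p} {l : List (Fin p)}
    (h : G.IsActive S (b :: l))
    (hb : ∀ c, [b, c] <+: b :: l → (G.Adj a b ∧ G.Adj c b → G.IsAncestorOf b S) ∧
      (¬ (G.Adj a b ∧ G.Adj c b) → b ∉ S)) : G.IsActive S (a :: b :: l) := by
  intro x y z hxyz
  rcases List.infix_cons_iff.1 hxyz with h1 | h1
  · simp only [List.cons_prefix_cons] at h1
    obtain ⟨rfl, rfl, h1⟩ := h1
    exact hb z (by simpa using h1)
  · exact h x y z h1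

theorem le_of_reflTransGen {G : DAG p} {t : Fin p → Fin p} (ht : ∀ a b, G.Adj a b → t a < t b)
    {a b : Fin p} (h : Relation.ReflTransGen G.Adj a b) : t a ≤ t b := by
  induction h with
  | refl => exact le_rfl
  | tail _ h ih => exact ih.trans (ht _ _ h).le

/-- Along an active walk which starts with an arrow into the future of `v`, and is conditioned
on the past of `v`, one stays in the future of `v`. -/
theorem lt_getLast_of_active {G : DAG p} {t : Fin p → Fin p} (ht : ∀ a b, G.Adj a b → t a < t b)
    {S : Finset (Fin p)} {v : Fin p} (hS : ∀ w ∈ S, t w < t v) :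
    ∀ (l : List (Fin p)) (a b u : Fin p), t v ≤ t a → G.Adj a b →
      (a :: b :: l).IsChain (fun a b => G.Adj a b ∨ G.Adj b a) → G.IsActive S (a :: b :: l) →
      (a :: b :: l).getLast? = some u → t v < t u := by
  intro l
  induction l with
  | nil =>
    intro a b u hva hab _ _ hu
    simp only [List.getLast?_cons_cons, List.getLast?_singleton, Option.some.injEq] at hu
    subst hu
    exact hva.trans_lt (ht _ _ hab)
  | cons c l ih =>
    intro a b u hva hab hch hact hu
    have hlt := hva.trans_lt (ht _ _ hab)
    have hbc := (List.isChain_cons_cons.1 (List.isChain_cons_cons.1 hch).2).1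
    -- A collider at `b` would need a descendant of `b` in `S`, but `b` is later than `v` and `S` is
    -- earlier.
    have hcb : ¬ G.Adj c b := by
      intro hcb
      obtain ⟨d, hd, hbd⟩ := (hact a b c ⟨[], l, by simp⟩).1 ⟨hab, hcb⟩
      have : t b ≤ t d := le_of_reflTransGen ht hbd
      exact absurd (hlt.trans_le this) (hS d hd).le.not_gt
    exact ih b c u hlt.le (hbc.resolve_right hcb) (List.isChain_cons_cons.1 hch).2 hact.tail
      (by simpa using hu)

/-- In a topological order, a vertex is d-separated from any earlier vertex which is not a parent
by the remaining earlier vertices. -/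
theorem dsep_of_not_adj {G : DAG p} {t : Fin p → Fin p} (ht : ∀ a b, G.Adj a b → t a < t b)
    {S : Finset (Fin p)} {u v : Fin p} (huv : t u < t v) (hS : ∀ w, w ∈ S ↔ t w < t v ∧ w ≠ u)
    (hadj : ¬ G.Adj u v) : G.DSep u v S := by
  apply DSep.symm
  rintro ⟨l, hv, hu, ⟨hnd, hch⟩, hact⟩
  match l, hv with
  | [v'], hv =>
    simp only [List.head?_cons, Option.some.injEq, List.getLast?_singleton] at hv hu
    rw [← hv, ← hu] at huv
    exact lt_irrefl _ huv
  | v' :: w :: l, hv =>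
    obtain rfl : v' = v := by simpa using hv
    have hvw := (List.isChain_cons_cons.1 hch).1
    by_cases hwv : G.Adj w v'
    · have hwu : w ≠ u := by rintro rfl; exact hadj hwv
      have hwS : w ∈ S := (hS w).2 ⟨ht _ _ hwv, hwu⟩
      match l with
      | [] => exact hwu (by simpa using hu)
      | x :: l =>
        exact (hact v' w x ⟨[], l, by simp⟩).2 (fun h => G.not_adj_symm hwv h.1) hwS
    · exact absurd (lt_getLast_of_active ht (fun w hw => ((hS w).1 hw).1) l v' w u le_rfl
        (hvw.resolve_right hwv) hch hact hu) huv.not_gt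

theorem not_dsep_of_adj {G : DAG p} {j k : Fin p} (h : G.Adj j k ∨ G.Adj k j)
    (S : Finset (Fin p)) : ¬ G.DSep j k S := by
  intro hs
  have hne : j ≠ k := h.elim G.adj_ne fun h => (G.adj_ne h).symm
  refine hs ⟨[j, k], rfl, rfl, ⟨by simpa using hne, by simpa using h⟩, fun a b c habc => ?_⟩
  have := habc.length_le
  simp at this

/-- Non-adjacent vertices are separated by the other predecessors of the later one in a topological
order. Hence d-separation determines the skeleton. -/
theorem adj_or_adj_iff {G : DAG p} {j k : Fin p} (hjk : j ≠ k) :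
    (G.Adj j k ∨ G.Adj k j) ↔ ∀ S, IsTriple j k S → ¬ G.DSep j k S := by
  classical
  refine ⟨fun h S _ => not_dsep_of_adj h S, fun h => ?_⟩
  by_contra! hno
  obtain ⟨π, hπ⟩ := G.exists_topological
  rcases lt_or_gt_of_ne (fun h => hjk (π.symm.injective h) : π.symm j ≠ π.symm k) with hlt | hlt
  · refine h ((Finset.univ.filter fun w => π.symm w < π.symm k).erase j) ⟨hjk, by simp, by simp⟩
      (dsep_of_not_adj hπ hlt (fun w => ?_) hno.1)
    simp [and_comm]
  · refine h ((Finset.univ.filter fun w => π.symm w < π.symm j).erase k) ⟨hjk, by simp, by simp⟩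
      (dsep_of_not_adj hπ hlt (fun w => ?_) hno.2).symm
    simp [and_comm]

theorem two_mul_numEdges (G : DAG p) :
    2 * G.numEdges = {e : Fin p × Fin p | G.Adj e.1 e.2 ∨ G.Adj e.2 e.1}.ncard := by
  have h1 : {e : Fin p × Fin p | G.Adj e.1 e.2 ∨ G.Adj e.2 e.1} =
      {e : Fin p × Fin p | G.Adj e.1 e.2} ∪ Prod.swap '' {e : Fin p × Fin p | G.Adj e.1 e.2} := by
    ext ⟨a, b⟩
    simp
  rw [h1, Set.ncard_union_eq, Set.ncard_image_of_injective _ Prod.swap_injective, numEdges, two_mul]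
  rw [Set.disjoint_left]
  rintro ⟨a, b⟩ hab hba
  simp only [Set.mem_ofPred_eq, Set.image_swap_eq_preimage_swap, Set.mem_preimage,
    Prod.swap_prod_mk] at hab hba
  exact G.not_adj_symm hab hba

theorem numEdges_le_of_adj_imp {G H : DAG p} (h : ∀ u v, G.Adj u v → H.Adj u v) :
    G.numEdges ≤ H.numEdges :=
  Set.ncard_le_ncard (fun e he => h e.1 e.2 he) (Set.toFinite _)

theorem eq_of_adj_imp_of_numEdges_le {G H : DAG p} (h : ∀ u v, G.Adj u v → H.Adj u v)
    (hle : H.numEdges ≤ G.numEdges) : G = H := by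
  have := Set.eq_of_subset_of_ncard_le
    (show {e : Fin p × Fin p | G.Adj e.1 e.2} ⊆ {e | H.Adj e.1 e.2} from fun e he => h e.1 e.2 he)
    hle (Set.toFinite _)
  ext u v
  exact Set.ext_iff.1 this (u, v)

end DAG

variable {p : ℕ}

/-- Markov equivalent DAGs have equally many edges. -/
theorem MarkovEquiv.numEdges_eq {G H : DAG p} (h : MarkovEquiv G H) :
    G.numEdges = H.numEdges := by
  have : {e : Fin p × Fin p | G.Adj e.1 e.2 ∨ G.Adj e.2 e.1} =
      {e : Fin p × Fin p | H.Adj e.1 e.2 ∨ H.Adj e.2 e.1} := by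
    ext ⟨a, b⟩
    rcases eq_or_ne a b with rfl | hab
    · simp only [Set.mem_ofPred_eq, or_self]
      exact ⟨fun h => absurd rfl (G.adj_ne h), fun h => absurd rfl (H.adj_ne h)⟩
    · simp only [Set.mem_ofPred_eq, DAG.adj_or_adj_iff hab]
      exact forall₂_congr fun S hS => not_congr (h a b S hS)
  have h2 := G.two_mul_numEdges
  rw [this, ← H.two_mul_numEdges] at h2
  omega

theorem IsMarkov.mono {G : DAG p} {R R' : Fin p → Fin p → Finset (Fin p) → Prop}
    (h : IsMarkov G R) (hR : ∀ j k S, IsTriple j k S → R j k S → R' j k S) : IsMarkov G R' :=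
  fun j k S hS hd => hR j k S hS (h j k S hS hd)

theorem IsMarkov.of_markovEquiv {G H : DAG p} {R : Fin p → Fin p → Finset (Fin p) → Prop}
    (h : IsMarkov G R) (hGH : MarkovEquiv H G) : IsMarkov H R :=
  fun j k S hS hd => h j k S hS ((hGH j k S hS).1 hd)

/-- If `G` is Markov, then `G_π` is a subgraph of `G` for each topological ordering `π` of `G`. -/
theorem IsMarkov.adj_of_permDAG_adj {G : DAG p} {R : Fin p → Fin p → Finset (Fin p) → Prop}
    (h : IsMarkov G R) {π : Equiv.Perm (Fin p)} (hπ : ∀ u v, G.Adj u v → π.symm u < π.symm v)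
    (u v : Fin p) (huv : (permDAG R π).Adj u v) : G.Adj u v := by
  obtain ⟨i, m, him, rfl, rfl, hR⟩ := huv
  by_contra hno
  refine hR (h _ _ _ ⟨fun h => him.ne (π.injective h), by simp, by simp⟩
    (DAG.dsep_of_not_adj hπ (by simpa using him) (fun w => ?_) hno))
  simp only [Finset.mem_erase, Finset.mem_image, Finset.mem_filter, Finset.mem_univ, true_and,
    Equiv.symm_apply_apply]
  constructor
  · rintro ⟨h1, a, ha, rfl⟩
    exact ⟨by simpa using ha, h1⟩
  · rintro ⟨h1, h2⟩
    exact ⟨h2, π.symm w, h1, by simp⟩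

/-- Every DAG that the relations `R` associate to a permutation is Markov with respect to `R`. -/
def IsPermMarkov (R : Fin p → Fin p → Finset (Fin p) → Prop) : Prop :=
  ∀ π, IsMarkov (permDAG R π) R

/-- If `R` is permutation Markov and consists of relations with respect to which `G` is a sparsest
Markov representation, then the SP algorithm recovers the Markov equivalence class of `G` as soon
as it finds a DAG which has at most as many edges as `G`. -/
theorem IsPermMarkov.spOutput_eq {R Q : Fin p → Fin p → Finset (Fin p) → Prop}
    (hR : IsPermMarkov R) (hRQ : ∀ j k S, IsTriple j k S → R j k S → Q j k S) {G : DAG p}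
    (hG : IsSMR G Q) (hle : ∃ π, (permDAG R π).numEdges ≤ G.numEdges) :
    spOutput R = markovClass G := by
  have hmin : ∀ σ, (permDAG R σ).numEdges ≤ G.numEdges → MarkovEquiv (permDAG R σ) G := by
    intro σ hσ
    by_contra hno
    exact (hG.2 _ ((hR σ).mono hRQ) hno).not_ge hσ
  -- A sparser `permDAG R σ` would be Markov equivalent to `G`, hence have equally many edges.
  have hge : ∀ σ, G.numEdges ≤ (permDAG R σ).numEdges := by
    intro σ
    by_contra! hlt
    exact hlt.ne (hmin σ hlt.le).numEdges_eq
  obtain ⟨π, hπ⟩ := hle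
  ext H
  constructor
  · rintro ⟨σ, rfl, hσ⟩
    exact hmin σ ((hσ π).trans hπ)
  · intro hH
    -- `H` inherits the Markov property from the minimiser. For a topological order `σ` of `H`,
    -- `permDAG R σ` is a subgraph of `H` with no fewer edges, hence `H` itself.
    have hHR : IsMarkov H R := (hR π).of_markovEquiv
      fun j k S hS => (hH j k S hS).trans (hmin π hπ j k S hS).symm
    obtain ⟨σ, hσ⟩ := H.exists_topological
    have hHG := MarkovEquiv.numEdges_eq hH
    have := DAG.eq_of_adj_imp_of_numEdges_le (hHR.adj_of_permDAG_adj hσ) (hHG.trans_le (hge σ))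
    exact ⟨σ, this.symm, fun τ => by rw [this, hHG]; exact hge τ⟩

end SP

/-! ### d-connecting walks and connectivity in the moral graph. -/

namespace SP

theorem exists_append_of_not_nodup {α : Type*} {l : List α} (h : ¬ l.Nodup) :
    ∃ b A M B, l = A ++ b :: (M ++ b :: B) := by
  induction l with
  | nil => simp at h
  | cons x t ih =>
    by_cases hx : x ∈ t
    · obtain ⟨M, B, rfl⟩ := List.append_of_mem hx
      exact ⟨x, [], M, B, rfl⟩
    · obtain ⟨b, A, M, B, rfl⟩ := ih fun ht => h (List.nodup_cons.2 ⟨hx, ht⟩)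
      exact ⟨b, x :: A, M, B, rfl⟩

/-- Used when a loop is cut out of a walk: only the triple centred at the junction `d` is new. -/
theorem infix_append_cons {α : Type*} {a b c d : α} {A B : List α}
    (h : [a, b, c] <:+: A ++ d :: B) :
    [a, b, c] <:+: A ++ [d] ∨ [a, b, c] <:+: d :: B ∨
      ∃ A' B', A = A' ++ [a] ∧ b = d ∧ B = c :: B' := by
  induction A with
  | nil => exact Or.inr (Or.inl h)
  | cons x A ih =>
    rw [List.cons_append] at h
    rcases List.infix_cons_iff.1 h with h1 | h1
    · rw [List.cons_prefix_cons] at h1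
      obtain ⟨rfl, h1⟩ := h1
      match A with
      | [] =>
        rw [List.nil_append, List.cons_prefix_cons] at h1
        obtain ⟨rfl, B', hB'⟩ := h1
        exact Or.inr (Or.inr ⟨[], B', rfl, rfl, hB'.symm⟩)
      | [y] =>
        simp only [List.cons_append, List.nil_append, List.cons_prefix_cons] at h1
        obtain ⟨rfl, rfl, -⟩ := h1
        exact Or.inl ⟨[], [], rfl⟩
      | y :: z :: A =>
        simp only [List.cons_append, List.cons_prefix_cons] at h1
        obtain ⟨rfl, rfl, -⟩ := h1
        exact Or.inl ⟨[], A ++ [d], rfl⟩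
    · rcases ih h1 with h2 | h2 | ⟨A', B', rfl, h2⟩
      · exact Or.inl (h2.trans (List.suffix_cons x _).isInfix)
      · exact Or.inr (Or.inl h2)
      · exact Or.inr (Or.inr ⟨x :: A', B', rfl, h2⟩)

namespace DAG

variable {p : ℕ}

/-- `l` is a d-connecting walk given `S` from `u` to `v`; vertices may be repeated. -/
def IsActiveWalk (G : DAG p) (S : Finset (Fin p)) (u v : Fin p) (l : List (Fin p)) : Prop :=
  l.head? = some u ∧ l.getLast? = some v ∧ l.IsChain (fun a b => G.Adj a b ∨ G.Adj b a) ∧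
    G.IsActive S l

theorem IsAncestorOf.of_adj {G : DAG p} {S : Finset (Fin p)} {a b : Fin p} (hab : G.Adj a b)
    (h : G.IsAncestorOf b S) : G.IsAncestorOf a S := by
  obtain ⟨d, hd, hbd⟩ := h
  exact ⟨d, hd, hbd.head hab⟩

theorem isAncestorOf_of_mem (G : DAG p) {S : Finset (Fin p)} {a : Fin p} (h : a ∈ S) :
    G.IsAncestorOf a S :=
  ⟨a, h, .refl⟩

/-- An active walk that leaves its first vertex along an arrow, and also arrives at its last vertex
against an arrow, contains a collider which descends from its first vertex. -/
theorem isAncestorOf_of_active {G : DAG p} {S : Finset (Fin p)} :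
    ∀ (l : List (Fin p)) (a b c d : Fin p), G.Adj a b →
      (a :: b :: l).IsChain (fun a b => G.Adj a b ∨ G.Adj b a) → G.IsActive S (a :: b :: l) →
      [c, d] <:+ a :: b :: l → G.Adj d c → G.IsAncestorOf a S := by
  intro l
  induction l with
  | nil =>
    intro a b c d hab _ _ hcd hdc
    have := hcd.eq_of_length rfl
    simp only [List.cons.injEq, and_true] at this
    obtain ⟨rfl, rfl⟩ := this
    exact absurd hdc (G.not_adj_symm hab)
  | cons x l ih =>
    intro a b c d hab hch hact hcd hdc
    have hbx := (List.isChain_cons_cons.1 (List.isChain_cons_cons.1 hch).2).1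
    by_cases hxb : G.Adj x b
    · exact ((hact a b x ⟨[], l, by simp⟩).1 ⟨hab, hxb⟩).of_adj hab
    · refine (ih b x c d (hbx.resolve_right hxb) (List.isChain_cons_cons.1 hch).2 hact.tail ?_
        hdc).of_adj hab
      rcases List.suffix_cons_iff.1 hcd with h | h
      · simp at h
      · exact h

/-- Only the junction `b` must be checked. If it becomes a collider, either it already was one at an
end of the loop, or the loop leaves `b` by arrows at both ends and contains an active collider
descending from `b`. If it becomes a non-collider, one of the two remaining edges does not point
into `b`, so `b` was a non-collider at that end before. -/
theorem IsActiveWalk.splice {G : DAG p} {S : Finset (Fin p)} {u v b : Fin p}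
    {A M B : List (Fin p)} (h : G.IsActiveWalk S u v (A ++ b :: (M ++ b :: B))) :
    G.IsActiveWalk S u v (A ++ b :: B) := by
  obtain ⟨hu, hv, hch, hact⟩ := h
  obtain ⟨hch1, hch2⟩ := List.isChain_split.1 hch
  have hch2' : List.IsChain _ ((b :: M) ++ b :: B) := hch2
  obtain ⟨hch3, hch4⟩ := List.isChain_split.1 hch2'
  refine ⟨?_, ?_, List.isChain_split.2 ⟨hch1, hch4⟩, ?_⟩
  · cases A <;> simpa using hu
  · have h2 : A ++ b :: (M ++ b :: B) = (A ++ b :: M) ++ b :: B := by simp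
    rw [h2, List.getLast?_append_cons] at hv
    rwa [List.getLast?_append_cons]
  intro x y z hxyz
  rcases infix_append_cons hxyz with h | h | ⟨A', B', rfl, rfl, rfl⟩
  · exact hact x y z (h.trans ⟨[], M ++ b :: B, by simp⟩)
  · exact hact x y z (h.trans ⟨A ++ b :: M, [], by simp⟩)
  obtain ⟨m, M, rfl⟩ : ∃ m M', M = m :: M' := by
    cases M with
    | nil =>
      have := (List.isChain_cons_cons.1 hch3).1
      exact absurd rfl (this.elim G.adj_ne G.adj_ne)
    | cons m M => exact ⟨m, M, rfl⟩
  obtain ⟨N, n, hN⟩ : ∃ N n, y :: m :: M = N ++ [n] := by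
    rw [← List.dropLast_append_getLast (List.cons_ne_nil y (m :: M))]
    exact ⟨_, _, rfl⟩
  have h1 := hact x y m ⟨A', M ++ y :: z :: B', by simp⟩
  have h2 := hact n y z ⟨A' ++ x :: N, B', by
    have : A' ++ [x] ++ y :: (m :: M ++ y :: z :: B') =
      A' ++ [x] ++ ((y :: m :: M) ++ y :: z :: B') := by simp
    rw [this, hN]; simp⟩
  constructor
  · rintro ⟨hx, hz⟩
    by_cases hm : G.Adj m y
    · exact h1.1 ⟨hx, hm⟩
    by_cases hn : G.Adj n y
    · exact h2.1 ⟨hn, hz⟩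
    have hny : G.Adj y n := by
      have h3 : List.IsChain (fun a b => G.Adj a b ∨ G.Adj b a) ((y :: m :: M) ++ [y]) := hch3
      rw [hN, List.append_assoc, List.isChain_append] at h3
      exact (List.isChain_cons_cons.1 h3.2.1).1.resolve_left hn
    have h3 : y :: m :: (M ++ [y]) = N ++ [n, y] := by
      calc y :: m :: (M ++ [y]) = (y :: m :: M) ++ [y] := by simp
        _ = _ := by rw [hN]; simp
    refine isAncestorOf_of_active (M ++ [y]) y m n y
      ((List.isChain_cons_cons.1 hch3).1.resolve_right hm) hch3 (fun a b c habc => ?_)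
      ⟨N, h3.symm⟩ hny
    exact hact a b c (habc.trans ⟨A' ++ [x], z :: B', by simp⟩)
  · intro hno
    by_cases hx : G.Adj x y
    · exact h2.2 fun h => hno ⟨hx, h.2⟩
    · exact h1.2 fun h => hx h.1

/-- Vertices joined by a d-connecting walk are not d-separated. -/
theorem IsActiveWalk.not_dsep {G : DAG p} {S : Finset (Fin p)} {u v : Fin p}
    {l : List (Fin p)} (h : G.IsActiveWalk S u v l) : ¬ G.DSep u v S := by
  induction hn : l.length using Nat.strong_induction_on generalizing l with
  | _ n ih =>
    by_cases hnd : l.Nodup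
    · exact fun hd => hd ⟨l, h.1, h.2.1, ⟨hnd, h.2.2.1⟩, h.2.2.2⟩
    · obtain ⟨b, A, M, B, rfl⟩ := exists_append_of_not_nodup hnd
      refine ih _ ?_ h.splice rfl
      subst hn
      simp only [List.length_append, List.length_cons]
      omega

theorem IsActiveWalk.cons {G : DAG p} {S : Finset (Fin p)} {a b v : Fin p} {l : List (Fin p)}
    (h : G.IsActiveWalk S b v l) (hab : G.Adj a b ∨ G.Adj b a)
    (hb : ∀ c, [b, c] <+: l → (G.Adj a b ∧ G.Adj c b → G.IsAncestorOf b S) ∧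
      (¬ (G.Adj a b ∧ G.Adj c b) → b ∉ S)) : G.IsActiveWalk S a v (a :: l) := by
  obtain ⟨h1, h2, h3, h4⟩ := h
  match l, h1 with
  | b' :: l, h1 =>
    obtain rfl : b' = b := by simpa using h1
    exact ⟨rfl, by simpa using h2, List.isChain_cons_cons.2 ⟨hab, h3⟩, h4.cons hb⟩

theorem IsActiveWalk.cons_of_adj {G : DAG p} {S : Finset (Fin p)} {a b v : Fin p}
    {l : List (Fin p)} (h : G.IsActiveWalk S b v l) (hab : G.Adj b a) (hb : b ∉ S) :
    G.IsActiveWalk S a v (a :: l) :=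
  h.cons (Or.inr hab) fun _ _ => ⟨fun h => absurd h.1 (G.not_adj_symm hab), fun _ => hb⟩

/-- A directed path whose start has no descendant in `S` avoids `S`. The clause on the first step
makes `u` a non-collider when the walk is extended backwards. -/
theorem exists_isActiveWalk_of_reflTransGen {G : DAG p} {S : Finset (Fin p)} {u v : Fin p}
    (h : Relation.ReflTransGen G.Adj u v) (hu : ¬ G.IsAncestorOf u S) :
    ∃ l, G.IsActiveWalk S u v l ∧ ∀ c, [u, c] <+: l → G.Adj u c := by
  induction h using Relation.ReflTransGen.head_induction_on with
  | refl =>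
    refine ⟨[v], ⟨rfl, rfl, by simp, fun a b c habc => ?_⟩, fun c hc => ?_⟩
    · simpa using habc.length_le
    · simpa using hc.length_le
  | head hab _ ih =>
    rename_i a b _
    have hb : ¬ G.IsAncestorOf b S := fun h => hu (h.of_adj hab)
    obtain ⟨l, hl, hl'⟩ := ih hb
    refine ⟨a :: l, hl.cons (Or.inl hab) fun c hc => ⟨fun h => absurd h.2
      (G.not_adj_symm (hl' c hc)), fun _ hS => hb (G.isAncestorOf_of_mem hS)⟩, fun c hc => ?_⟩
    match l, hl.1 with
    | b' :: l, h1 =>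
      obtain rfl : b' = b := by simpa using h1
      simp only [List.cons_prefix_cons, List.nil_prefix, true_and, and_true] at hc
      rwa [hc]

theorem exists_isActiveWalk_of_descendant {G : DAG p} {S : Finset (Fin p)} {u v w : Fin p}
    (h : Relation.ReflTransGen G.Adj u w) (hu : ¬ G.IsAncestorOf u S)
    (hl : ∃ l, G.IsActiveWalk S u v l) : ∃ l, G.IsActiveWalk S w v l := by
  induction h using Relation.ReflTransGen.head_induction_on with
  | refl => exact hl
  | head hab _ ih =>
    obtain ⟨l, hl⟩ := hl
    exact ih (fun h => hu (h.of_adj hab))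
      ⟨_, hl.cons_of_adj hab fun hS => hu (G.isAncestorOf_of_mem hS)⟩

/-- Suppose that `j` and `k` are d-separated by `S`. Amongst the ancestors of `j`, `k` and `S`
which lie outside of `S`, the set of those joined to `k` by a d-connecting walk is closed under
adjacency in the moral graph. -/
theorem exists_isActiveWalk_of_moral {G : DAG p} {S : Finset (Fin p)} {j k : Fin p}
    (hd : G.DSep j k S) {v a b : Fin p}
    (hv : G.IsAncestorOf v (insert j (insert k S)))
    (hav : a = v ∨ G.Adj a v) (hbv : b = v ∨ G.Adj b v) (ha : a ∉ S)
    (hl : ∃ l, G.IsActiveWalk S a k l) : ∃ l, G.IsActiveWalk S b k l := by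
  have hcases : ¬ G.IsAncestorOf v S →
      Relation.ReflTransGen G.Adj v j ∨ Relation.ReflTransGen G.Adj v k := by
    intro hvS
    obtain ⟨d, hd, hvd⟩ := hv
    rcases Finset.mem_insert.1 hd with rfl | hd
    · exact Or.inl hvd
    rcases Finset.mem_insert.1 hd with rfl | hd
    · exact Or.inr hvd
    · exact absurd ⟨d, hd, hvd⟩ hvS
  -- A walk from `v` to `k` would extend to one from `j` if `v` were an ancestor of `j`. So `v` is
  -- an ancestor of `k`, and `b → v → ⋯ → k` is active.
  have hback : ¬ G.IsAncestorOf v S → (∃ l, G.IsActiveWalk S v k l) → G.Adj b v →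
      ∃ l, G.IsActiveWalk S b k l := by
    intro hvS hl hbv
    rcases hcases hvS with hvj | hvk
    · obtain ⟨l, hl⟩ := exists_isActiveWalk_of_descendant hvj hvS hl
      exact absurd hd hl.not_dsep
    · obtain ⟨l, hl, hl'⟩ := exists_isActiveWalk_of_reflTransGen hvk hvS
      exact ⟨b :: l, hl.cons (Or.inl hbv) fun c hc => ⟨fun h => absurd h.2
        (G.not_adj_symm (hl' c hc)), fun _ hS => hvS (G.isAncestorOf_of_mem hS)⟩⟩
  rcases hav with rfl | hav
  · rcases hbv with rfl | hbv
    · exact hl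
    by_cases hvS : G.IsAncestorOf a S
    · obtain ⟨l, hl⟩ := hl
      exact ⟨b :: l, hl.cons (Or.inl hbv) fun c hc => ⟨fun _ => hvS, fun _ => ha⟩⟩
    · exact hback hvS hl hbv
  · obtain ⟨l, hl⟩ := hl
    have hvl := hl.cons_of_adj hav ha
    rcases hbv with rfl | hbv
    · exact ⟨_, hvl⟩
    -- If `v` has a descendant in `S`, the collider `b → v ← a` is open.
    by_cases hvS : G.IsAncestorOf v S
    · refine ⟨b :: v :: l, hvl.cons (Or.inl hbv) fun c hc => ⟨fun _ => hvS, fun hno => ?_⟩⟩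
      match l, hl.1 with
      | a' :: l, h1 =>
        obtain rfl : a' = a := by simpa using h1
        simp only [List.cons_prefix_cons, List.nil_prefix, true_and, and_true] at hc
        subst hc
        exact absurd ⟨hbv, hav⟩ hno
    · exact hback hvS ⟨_, hvl⟩ hbv

end DAG
end SP

/-! ### Regression residuals and the Gaussian global Markov property. -/

namespace SP

open Matrix

variable {p : ℕ}

/-- The coefficients of the residual `X_j - ∑ s ∈ S, c_s X_s` of the regression of `X_j` on
`X_S`. -/
noncomputable def residual (A : Matrix (Fin p) (Fin p) ℝ) (S : Finset (Fin p)) (j : Fin p) :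
    Fin p → ℝ := fun v =>
  (Pi.single j 1 : Fin p → ℝ) v - if h : v ∈ S then
    (((A.submatrix (fun s : S => (s : Fin p)) (fun s : S => (s : Fin p)))⁻¹ *
      A.submatrix (fun s : S => (s : Fin p)) id) ⟨v, h⟩ j) else 0

theorem residual_of_not_mem (A : Matrix (Fin p) (Fin p) ℝ) {S : Finset (Fin p)} (j : Fin p)
    {v : Fin p} (hv : v ∉ S) : residual A S j v = (Pi.single j 1 : Fin p → ℝ) v := by
  simp [residual, hv]

theorem mulVec_residual (A : Matrix (Fin p) (Fin p) ℝ) (S : Finset (Fin p)) (j k : Fin p) :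
    (A *ᵥ residual A S j) k = A k j - ∑ s : S, A k s *
      ((A.submatrix (fun s : S => (s : Fin p)) (fun s : S => (s : Fin p)))⁻¹ *
      A.submatrix (fun s : S => (s : Fin p)) id) s j := by
  classical
  simp only [mulVec, dotProduct, residual, mul_sub, Finset.sum_sub_distrib]
  congr 1
  · simp [Pi.single_apply]
  · rw [← Finset.sum_subset (Finset.subset_univ S)]
    · rw [← Finset.sum_coe_sort S]
      exact Finset.sum_congr rfl fun s _ => by simp
    · intro x _ hx
      simp [hx]

theorem partialCov_eq (A : Matrix (Fin p) (Fin p) ℝ) (S : Finset (Fin p)) (j k : Fin p) :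
    partialCov A S k j = (A *ᵥ residual A S j) k := by
  rw [mulVec_residual, partialCov, Matrix.sub_apply, Matrix.mul_assoc, Matrix.mul_apply]
  rfl

variable {A : Matrix (Fin p) (Fin p) ℝ}

/-- The normal equations: the residual is uncorrelated with `X_S`. -/
theorem mulVec_residual_of_mem (hA : A.PosDef) {S : Finset (Fin p)} (j : Fin p) {s : Fin p}
    (hs : s ∈ S) : (A *ᵥ residual A S j) s = 0 := by
  rw [mulVec_residual]
  set B := A.submatrix (fun s : S => (s : Fin p)) (fun s : S => (s : Fin p)) with hB
  have hBp : B.PosDef := hA.submatrix Subtype.val_injective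
  have h : B * (B⁻¹ * A.submatrix (fun s : S => (s : Fin p)) id) =
      A.submatrix (fun s : S => (s : Fin p)) id := by
    rw [← Matrix.mul_assoc, Matrix.mul_nonsing_inv _ ((Matrix.isUnit_iff_isUnit_det _).1 hBp.isUnit),
      Matrix.one_mul]
  have h2 := congrFun (congrFun h ⟨s, hs⟩) j
  rw [Matrix.mul_apply] at h2
  exact sub_eq_zero.2 h2.symm

theorem dotProduct_mulVec_comm (hA : A.PosDef) (x y : Fin p → ℝ) :
    x ⬝ᵥ A *ᵥ y = y ⬝ᵥ A *ᵥ x := by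
  rw [dotProduct_mulVec, dotProduct_comm, ← mulVec_transpose]
  have h : Aᵀ = A := by simpa using hA.isHermitian.eq
  rw [h]

theorem dotProduct_mulVec_pos (hA : A.PosDef) {x : Fin p → ℝ} (hx : x ≠ 0) :
    0 < x ⬝ᵥ A *ᵥ x := by
  simpa using hA.dotProduct_mulVec_pos hx

/-- Pairing a vector which represents `X_k` modulo `X_S` with the residual of `X_j`. -/
theorem dotProduct_mulVec_residual (hA : A.PosDef) {S : Finset (Fin p)} (j k : Fin p)
    {z : Fin p → ℝ} (hz : ∀ v ∉ S, z v = (Pi.single k 1 : Fin p → ℝ) v) (hk : k ∉ S) :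
    z ⬝ᵥ A *ᵥ residual A S j = partialCov A S k j := by
  rw [partialCov_eq, dotProduct, Finset.sum_eq_single k]
  · rw [hz k hk]; simp
  · intro b _ hb
    by_cases hbS : b ∈ S
    · rw [mulVec_residual_of_mem hA j hbS, mul_zero]
    · rw [hz b hbS]; simp [hb]
  · simp

theorem residual_ne_zero {S : Finset (Fin p)} {j : Fin p} (hj : j ∉ S) : residual A S j ≠ 0 := by
  intro h
  have := congrFun h j
  rw [residual_of_not_mem A j hj] at this
  simp at this

theorem partialCov_self_eq (hA : A.PosDef) {S : Finset (Fin p)} {j : Fin p} (hj : j ∉ S) :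
    residual A S j ⬝ᵥ A *ᵥ residual A S j = partialCov A S j j :=
  dotProduct_mulVec_residual hA j j (fun _ hv => residual_of_not_mem A j hv) hj

theorem partialCov_self_pos (hA : A.PosDef) {S : Finset (Fin p)} {j : Fin p} (hj : j ∉ S) :
    0 < partialCov A S j j := by
  rw [← partialCov_self_eq hA hj]
  exact dotProduct_mulVec_pos hA (residual_ne_zero hj)

theorem partialCov_comm (hA : A.PosDef) {S : Finset (Fin p)} {j k : Fin p} (hj : j ∉ S)
    (hk : k ∉ S) : partialCov A S j k = partialCov A S k j := by
  rw [← dotProduct_mulVec_residual hA j k (fun _ hv => residual_of_not_mem A k hv) hk,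
    ← dotProduct_mulVec_residual hA k j (fun _ hv => residual_of_not_mem A j hv) hj,
    dotProduct_mulVec_comm hA]

theorem partialCorr_eq_zero_iff (hA : A.PosDef) {S : Finset (Fin p)} {j k : Fin p} (hj : j ∉ S)
    (hk : k ∉ S) : partialCorr A j k S = 0 ↔ partialCov A S j k = 0 := by
  have := Real.sqrt_pos.2 (mul_pos (partialCov_self_pos hA hj) (partialCov_self_pos hA hk))
  simp [partialCorr, this.ne']

/-- Two solutions of the normal equations differ by a vector supported on `S` whose image under `A`
vanishes on `S`; its quadratic form is zero. -/
theorem eq_residual (hA : A.PosDef) {S : Finset (Fin p)} {k : Fin p} {z : Fin p → ℝ}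
    (hz : ∀ v ∉ S, z v = (Pi.single k 1 : Fin p → ℝ) v) (hz' : ∀ s ∈ S, (A *ᵥ z) s = 0) :
    z = residual A S k := by
  by_contra hne
  have h := dotProduct_mulVec_pos hA (sub_ne_zero.2 hne)
  rw [dotProduct, Finset.sum_eq_zero] at h
  · exact lt_irrefl _ h
  intro v _
  by_cases hv : v ∈ S
  · simp [mulVec_sub, hz' v hv, mulVec_residual_of_mem hA k hv]
  · rw [Pi.sub_apply, hz v hv, residual_of_not_mem A k hv]; simp

/-- A residual coefficient vanishes along with the corresponding partial covariance. -/
theorem residual_eq_zero_of_partialCov (hA : A.PosDef) {P : Finset (Fin p)} {a v : Fin p}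
    (ha : a ∈ P) (hv : v ∉ P) (h : partialCov A (P.erase a) a v = 0) : residual A P v a = 0 := by
  have ha' : a ∉ P.erase a := by simp
  have hv' : v ∉ P.erase a := fun h => hv (Finset.mem_of_mem_erase h)
  have h1 : residual A (P.erase a) a ⬝ᵥ A *ᵥ residual A P v = 0 := by
    refine Finset.sum_eq_zero fun b _ => ?_
    by_cases hb : b ∈ P
    · rw [mulVec_residual_of_mem hA v hb, mul_zero]
    · have hba : b ≠ a := fun h => hb (h ▸ ha)
      rw [residual_of_not_mem A a (fun h => hb (Finset.mem_of_mem_erase h))]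
      simp [hba]
  -- Evaluated the other way, the pairing is the coefficient at `a` times a positive conditional
  -- variance, plus the partial covariance at `v`, which vanishes.
  rw [dotProduct_mulVec_comm hA, dotProduct, Finset.sum_eq_single a] at h1
  · rw [← partialCov_eq] at h1
    exact (mul_eq_zero.1 h1).resolve_right (partialCov_self_pos hA ha').ne'
  · intro b _ hba
    by_cases hb : b ∈ P
    · rw [mulVec_residual_of_mem hA a (Finset.mem_erase.2 ⟨hba, hb⟩), mul_zero]
    · rcases eq_or_ne b v with rfl | hbv
      · rw [← partialCov_eq, partialCov_comm hA hv' ha', h, mul_zero]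
      · rw [residual_of_not_mem A v hb]; simp [hbv]
  · simp

/-- The global Markov property of a Gaussian structural equation model: suppose that
`ε_v = ∑ a, y v a * X_a` are uncorrelated, where `y v` is supported on `v` and its parents. Then
d-separation implies vanishing of partial covariances. -/
theorem partialCov_eq_zero_of_dsep (hA : A.PosDef) {G : DAG p} {y : Fin p → Fin p → ℝ}
    (hy : ∀ v, y v v = 1) (hyG : ∀ v a, y v a ≠ 0 → a = v ∨ G.Adj a v)
    (horth : ∀ u v, u ≠ v → y u ⬝ᵥ A *ᵥ y v = 0) {j k : Fin p} {S : Finset (Fin p)}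
    (hS : IsTriple j k S) (hd : G.DSep j k S) : partialCov A S j k = 0 := by
  classical
  obtain ⟨hjk, hj, hk⟩ := hS
  set d : Fin p → ℝ := fun v => y v ⬝ᵥ A *ᵥ y v with hd_def
  have hdpos : ∀ v, 0 < d v := by
    intro v
    refine dotProduct_mulVec_pos hA fun h => ?_
    have := congrFun h v
    rw [hy] at this
    simp at this
  -- The ancestral set of `j`, `k` and `S`; the marginal model on it uses only the equations of its
  -- own vertices.
  set U : Finset (Fin p) :=
    Finset.univ.filter fun v => G.IsAncestorOf v (insert j (insert k S)) with hU
  have hUpar : ∀ v ∈ U, ∀ a, y v a ≠ 0 → a ∈ U := by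
    intro v hv a ha
    rcases hyG v a ha with rfl | h
    · exact hv
    · simp only [hU, Finset.mem_filter, Finset.mem_univ, true_and] at hv ⊢
      exact hv.of_adj h
  have hmemU : ∀ v ∈ insert j (insert k S), v ∈ U := by
    intro v hv
    simp only [hU, Finset.mem_filter, Finset.mem_univ, true_and]
    exact G.isAncestorOf_of_mem hv
  -- expansion in the orthogonal basis `y`
  have hfull : ∀ (x : Fin p → ℝ) w, ∑ v, (A *ᵥ y v) w * ((d v)⁻¹ * (y v ⬝ᵥ x)) = x w := by
    intro x w
    have h1 : (Matrix.of y) * (A * (Matrix.of y)ᵀ * Matrix.diagonal fun v => (d v)⁻¹) = 1 := by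
      rw [← Matrix.mul_assoc]
      ext u v
      rw [Matrix.mul_diagonal]
      have h2 : (Matrix.of y * (A * (Matrix.of y)ᵀ)) u v = y u ⬝ᵥ A *ᵥ y v := rfl
      rw [h2]
      rcases eq_or_ne u v with rfl | huv
      · rw [Matrix.one_apply_eq]
        exact mul_inv_cancel₀ (hdpos u).ne'
      · rw [horth u v huv, Matrix.one_apply_ne huv, zero_mul]
    have hN : ∀ v, (A * (Matrix.of y)ᵀ * Matrix.diagonal fun v => (d v)⁻¹) w v =
        (A *ᵥ y v) w * (d v)⁻¹ := fun v => by rw [Matrix.mul_diagonal]; rfl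
    have h2 := congrFun (congrArg (· *ᵥ x) (_root_.mul_eq_one_comm.1 h1)) w
    simp only [one_mulVec] at h2
    rw [← Matrix.mulVec_mulVec, mulVec, dotProduct] at h2
    rw [← h2]
    refine Finset.sum_congr rfl fun v _ => ?_
    rw [hN, mul_assoc]
    rfl
  -- Noise outside the ancestral set is uncorrelated with `X_w`, by induction along a topological
  -- order, since `X_w` combines its own noise and its parents.
  have hzero : ∀ v ∉ U, ∀ w ∈ U, (A *ᵥ y v) w = 0 := by
    obtain ⟨π, hπ⟩ := G.exists_topological
    intro v hv w
    induction hn : π.symm w using WellFoundedLT.induction generalizing w with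
    | _ n ih =>
      intro hw
      have h1 := horth w v fun h => hv (h ▸ hw)
      rw [dotProduct, Finset.sum_eq_single w, hy, one_mul] at h1
      · exact h1
      · intro a _ haw
        by_cases hya : y w a = 0
        · rw [hya, zero_mul]
        · have := (hyG w a hya).resolve_left haw
          rw [ih _ (hn ▸ hπ _ _ this) a rfl (hUpar w hw a hya), mul_zero]
      · simp
  -- the precision matrix of `X_U`
  let T : (Fin p → ℝ) →ₗ[ℝ] (Fin p → ℝ) :=
    { toFun := fun x => ∑ v ∈ U, ((d v)⁻¹ * (y v ⬝ᵥ x)) • y v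
      map_add' := fun x x' => by
        simp only [dotProduct_add, mul_add, add_smul, Finset.sum_add_distrib]
      map_smul' := fun c x => by
        simp only [dotProduct_smul, smul_eq_mul, RingHom.id_apply, Finset.smul_sum, smul_smul]
        exact Finset.sum_congr rfl fun v _ => by congr 1; ring }
  have hT : ∀ x, T x = ∑ v ∈ U, ((d v)⁻¹ * (y v ⬝ᵥ x)) • y v := fun _ => rfl
  have hAT : ∀ x, ∀ w ∈ U, (A *ᵥ T x) w = x w := by
    intro x w hw
    rw [← hfull x w, hT, mulVec_sum, Finset.sum_apply]
    rw [← Finset.sum_subset (Finset.subset_univ U)]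
    · refine Finset.sum_congr rfl fun v _ => ?_
      rw [mulVec_smul, Pi.smul_apply, smul_eq_mul, mul_comm]
    · intro v _ hv
      rw [hzero v hv w hw, zero_mul]
  -- A union of moral-graph components of `U \ S`, containing `k` but not `j`; the residual of `X_k`
  -- given `X_S` will be found as `T x` with `x` supported on `C`.
  set C : Finset (Fin p) :=
    Finset.univ.filter fun v => v ∈ U ∧ v ∉ S ∧ ∃ l, G.IsActiveWalk S v k l with hC
  have hmemC : ∀ v, v ∈ C ↔ v ∈ U ∧ v ∉ S ∧ ∃ l, G.IsActiveWalk S v k l := by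
    intro v; simp [hC]
  have hkC : k ∈ C := (hmemC k).2 ⟨hmemU k (by simp), hk, [k], rfl, rfl, by simp,
    fun a b c habc => by simpa using habc.length_le⟩
  have hjC : j ∉ C := by
    intro h
    obtain ⟨-, -, l, hl⟩ := (hmemC j).1 h
    exact hl.not_dsep hd
  obtain ⟨x, hxC, hTx⟩ : ∃ x : Fin p → ℝ, (∀ v ∉ C, x v = 0) ∧
      ∀ v ∈ C, T x v = (Pi.single k 1 : Fin p → ℝ) v := by
    -- The system `T x = e_k` on `C`, `x = 0` off `C`, is square. It is injective because the form
    -- of `T` is a sum of squares and `A T` is the identity on `U`.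
    let Φ : (Fin p → ℝ) →ₗ[ℝ] (Fin p → ℝ) :=
      LinearMap.pi fun v => if v ∈ C then LinearMap.proj v ∘ₗ T else LinearMap.proj v
    have hΦ1 : ∀ x, ∀ v ∈ C, Φ x v = T x v := by
      intro x v hv
      simp [Φ, hv]
    have hΦ2 : ∀ x, ∀ v ∉ C, Φ x v = x v := by
      intro x v hv
      simp [Φ, hv]
    have hinj : Function.Injective Φ := by
      rw [← LinearMap.ker_eq_bot, LinearMap.ker_eq_bot']
      intro x hx
      have h1 : x ⬝ᵥ T x = 0 := by
        refine Finset.sum_eq_zero fun v _ => ?_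
        by_cases hv : v ∈ C
        · rw [← hΦ1 x v hv, hx]; simp
        · rw [← hΦ2 x v hv, hx]; simp
      have h2 : ∑ v ∈ U, (d v)⁻¹ * (y v ⬝ᵥ x) ^ 2 = 0 := by
        rw [← h1, hT, dotProduct_sum]
        refine Finset.sum_congr rfl fun v _ => ?_
        rw [dotProduct_smul, smul_eq_mul, dotProduct_comm x]
        ring
      rw [Finset.sum_eq_zero_iff_of_nonneg
        (fun v _ => mul_nonneg (inv_nonneg.2 (hdpos v).le) (sq_nonneg _))] at h2
      have h3 : T x = 0 := by
        rw [hT]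
        refine Finset.sum_eq_zero fun v hv => ?_
        have := (mul_eq_zero.1 (h2 v hv)).resolve_left (inv_ne_zero (hdpos v).ne')
        rw [pow_eq_zero_iff two_ne_zero] at this
        rw [this, mul_zero, zero_smul]
      funext v
      by_cases hv : v ∈ C
      · rw [← hAT x v ((hmemC v).1 hv).1, h3]; simp
      · rw [← hΦ2 x v hv, hx]
    obtain ⟨x, hx⟩ := LinearMap.injective_iff_surjective.1 hinj (Pi.single k 1)
    refine ⟨x, fun v hv => ?_, fun v hv => ?_⟩
    · rw [← hΦ2 x v hv, hx]
      have : v ≠ k := fun h => hv (h ▸ hkC)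
      simp [this]
    · rw [← hΦ1 x v hv, hx]
  have hres : T x = residual A S k := by
    refine eq_residual hA (fun a haS => ?_) fun s hs => ?_
    · by_cases haC : a ∈ C
      · exact hTx a haC
      have hak : a ≠ k := fun h => haC (h ▸ hkC)
      rw [Pi.single_eq_of_ne hak, hT, Finset.sum_apply]
      refine Finset.sum_eq_zero fun v hv => ?_
      rw [Pi.smul_apply, smul_eq_mul]
      by_cases hya : y v a = 0
      · rw [hya, mul_zero]
      -- If `a` and some `c ∈ C` both occur in the equation of `v`, they are moral neighbours or
      -- equal, which forces `a ∈ C`.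
      have : y v ⬝ᵥ x = 0 := by
        refine Finset.sum_eq_zero fun c _ => ?_
        by_cases hc : c ∈ C
        · by_cases hyc : y v c = 0
          · rw [hyc, zero_mul]
          · obtain ⟨-, hcS, hl⟩ := (hmemC c).1 hc
            refine absurd ((hmemC a).2 ⟨hUpar v hv a hya, haS, ?_⟩) haC
            exact DAG.exists_isActiveWalk_of_moral hd (by simpa [hU] using hv) (hyG v c hyc)
              (hyG v a hya) hcS hl
        · rw [hxC c hc, mul_zero]
      rw [this, mul_zero, zero_mul]
    · rw [hAT x s (hmemU s (by simp [hs]))]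
      exact hxC s fun h => ((hmemC s).1 h).2.1 hs
  rw [partialCov_eq, ← hres, hAT x j (hmemU j (by simp))]
  exact hxC j hjC

/-- The conditional independence relations of a nondegenerate Gaussian distribution are
permutation Markov. -/
theorem isPermMarkov_of_iff (hA : A.PosDef) {R : Fin p → Fin p → Finset (Fin p) → Prop}
    (hR : ∀ j k S, IsTriple j k S → (R j k S ↔ partialCorr A j k S = 0)) : IsPermMarkov R := by
  classical
  intro π j k S hS hd
  rw [hR j k S hS, partialCorr_eq_zero_iff hA hS.2.1 hS.2.2]
  -- The noise of `v` is its residual given all its predecessors. Non-edges of `permDAG R π` are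
  -- vanishing partial covariances, hence vanishing regression coefficients.
  let P : Fin p → Finset (Fin p) := fun v => (Finset.univ.filter (· < π.symm v)).image π
  have hP : ∀ v a, a ∈ P v ↔ π.symm a < π.symm v := by
    intro v a
    simp only [P, Finset.mem_image, Finset.mem_filter, Finset.mem_univ, true_and]
    exact ⟨by rintro ⟨b, hb, rfl⟩; simpa using hb, fun h => ⟨_, h, by simp⟩⟩
  have hself : ∀ v, v ∉ P v := by simp [hP]
  have hsupp : ∀ v a, residual A (P v) v a ≠ 0 → a = v ∨ a ∈ P v := by
    intro v a ha
    by_contra! hno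
    rw [residual_of_not_mem A v hno.2] at ha
    simp [hno.1] at ha
  have horth : ∀ u v, π.symm u < π.symm v →
      residual A (P u) u ⬝ᵥ A *ᵥ residual A (P v) v = 0 := by
    intro u v huv
    refine Finset.sum_eq_zero fun a _ => ?_
    by_cases ha : residual A (P u) u a = 0
    · rw [ha, zero_mul]
    · rw [mulVec_residual_of_mem hA v, mul_zero]
      rcases hsupp u a ha with rfl | h
      · exact (hP v a).2 huv
      · exact (hP v a).2 (((hP u a).1 h).trans huv)
  refine partialCov_eq_zero_of_dsep (y := fun v => residual A (P v) v) hA (fun v => ?_)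
    (fun v a ha => ?_) (fun u v huv => ?_) hS hd
  · rw [residual_of_not_mem A v (hself v)]; simp
  · rcases hsupp v a ha with h | h
    · exact Or.inl h
    refine Or.inr ⟨π.symm a, π.symm v, (hP v a).1 h, by simp, by simp, fun hno => ha ?_⟩
    have hav : a ≠ v := fun h' => hself v (h' ▸ h)
    simp only [Equiv.apply_symm_apply] at hno
    change R a v ((P v).erase a) at hno
    have hv' : v ∉ (P v).erase a := fun h => hself v (Finset.mem_of_mem_erase h)
    rw [hR _ _ _ ⟨hav, by simp, hv'⟩, partialCorr_eq_zero_iff hA (by simp) hv'] at hno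
    exact residual_eq_zero_of_partialCov hA h (hself v) hno
  · rcases lt_or_gt_of_ne (fun h => huv (π.symm.injective h) : π.symm u ≠ π.symm v) with h | h
    · exact horth u v h
    · rw [dotProduct_mulVec_comm hA]
      exact horth v u h

end SP

/-! ### Stability of partial correlations under relative perturbation. -/

namespace SP

open Matrix

variable {p : ℕ} {A B : Matrix (Fin p) (Fin p) ℝ}

theorem dotProduct_mulVec_nonneg (hA : A.PosDef) (x : Fin p → ℝ) : 0 ≤ x ⬝ᵥ A *ᵥ x := by
  simpa using hA.posSemidef.dotProduct_mulVec_nonneg x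

/-- The conditional variance of `a X_j + b X_k` given `X_S` as a value of the quadratic form. -/
theorem residual_quadratic (hA : A.PosDef) {S : Finset (Fin p)} {j k : Fin p} (hj : j ∉ S)
    (hk : k ∉ S) (a b : ℝ) :
    (a • residual A S j + b • residual A S k) ⬝ᵥ A *ᵥ
      (a • residual A S j + b • residual A S k) =
    a ^ 2 * partialCov A S j j + 2 * (a * b) * partialCov A S j k +
      b ^ 2 * partialCov A S k k := by
  have h1 : residual A S j ⬝ᵥ A *ᵥ residual A S k = partialCov A S j k :=
    dotProduct_mulVec_residual hA k j (fun _ hv => residual_of_not_mem A j hv) hj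
  have h2 : residual A S k ⬝ᵥ A *ᵥ residual A S j = partialCov A S j k := by
    rw [dotProduct_mulVec_comm hA, h1]
  simp only [mulVec_add, mulVec_smul, add_dotProduct, dotProduct_add, smul_dotProduct,
    dotProduct_smul, h1, h2, partialCov_self_eq hA hj, partialCov_self_eq hA hk, smul_eq_mul]
  ring

/-- The conditional variance is the least variance of the vectors with the same coefficients
outside of `S`. -/
theorem residual_quadratic_le (hA : A.PosDef) {S : Finset (Fin p)} {j k : Fin p} (a b : ℝ)
    {z : Fin p → ℝ} (hz : ∀ v ∉ S, z v = (a • residual A S j + b • residual A S k) v) :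
    (a • residual A S j + b • residual A S k) ⬝ᵥ A *ᵥ
      (a • residual A S j + b • residual A S k) ≤ z ⬝ᵥ A *ᵥ z := by
  set y := a • residual A S j + b • residual A S k with hy
  have hAy : ∀ s ∈ S, (A *ᵥ y) s = 0 := by
    intro s hs
    simp [hy, mulVec_add, mulVec_smul, mulVec_residual_of_mem hA _ hs]
  have h1 : (z - y) ⬝ᵥ A *ᵥ y = 0 := by
    refine Finset.sum_eq_zero fun v _ => ?_
    by_cases hv : v ∈ S
    · rw [hAy v hv, mul_zero]
    · rw [Pi.sub_apply, hz v hv, sub_self, zero_mul]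
  have h2 := dotProduct_mulVec_nonneg hA (z - y)
  have h3 : y ⬝ᵥ A *ᵥ (z - y) = 0 := by rw [dotProduct_mulVec_comm hA, h1]
  have h4 : z ⬝ᵥ A *ᵥ z = (z - y) ⬝ᵥ A *ᵥ (z - y) + (z - y) ⬝ᵥ A *ᵥ y +
      y ⬝ᵥ A *ᵥ (z - y) + y ⬝ᵥ A *ᵥ y := by
    simp only [mulVec_sub, sub_dotProduct, dotProduct_sub]
    ring
  rw [h4, h1, h3]
  linarith

/-- Conditional variances inherit relative bounds from the variances. -/
theorem abs_partialCov_quadratic_sub_le (hA : A.PosDef) (hB : B.PosDef) {η : ℝ} (h1 : η ≤ 1)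
    (hBA : ∀ v, |v ⬝ᵥ B *ᵥ v - v ⬝ᵥ A *ᵥ v| ≤ η * (v ⬝ᵥ A *ᵥ v))
    {S : Finset (Fin p)} {j k : Fin p} (hj : j ∉ S) (hk : k ∉ S) (a b : ℝ) :
    |(a ^ 2 * partialCov B S j j + 2 * (a * b) * partialCov B S j k +
        b ^ 2 * partialCov B S k k) -
      (a ^ 2 * partialCov A S j j + 2 * (a * b) * partialCov A S j k +
        b ^ 2 * partialCov A S k k)| ≤
      η * (a ^ 2 * partialCov A S j j + 2 * (a * b) * partialCov A S j k +
        b ^ 2 * partialCov A S k k) := by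
  rw [← residual_quadratic hA hj hk, ← residual_quadratic hB hj hk]
  have hoff : ∀ v ∉ S, (a • residual A S j + b • residual A S k) v =
      (a • residual B S j + b • residual B S k) v := by
    intro v hv
    simp only [Pi.add_apply, Pi.smul_apply, residual_of_not_mem _ _ hv]
  -- Each minimiser competes in the other minimisation; `η ≤ 1` keeps the factor `1 - η` of the
  -- lower bound nonnegative.
  have h2 := residual_quadratic_le hA a b (fun v hv => (hoff v hv).symm)
  have h3 := residual_quadratic_le hB a b hoff
  have h4 := abs_le.1 (hBA (a • residual A S j + b • residual A S k))
  have h5 := abs_le.1 (hBA (a • residual B S j + b • residual B S k))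
  rw [abs_le]
  constructor
  · nlinarith
  · linarith

/-- After rescaling to `a = b = 1`, the vectors `(1,0)` and `(0,1)` control the variances. The
errors at `(1,1)` and `(1,-1)` add up to a bound `η` on the covariance error, independent of `ρ`.
Renormalising costs another `η`, since the new correlation is at most `1` in absolute value. -/
theorem abs_sub_le_of_quadratic {a b c a' b' c' η : ℝ} (ha : 0 < a) (hb : 0 < b) (ha' : 0 < a')
    (hb' : 0 < b') (h1 : η ≤ 1)
    (h : ∀ s t : ℝ, |(s ^ 2 * a' + 2 * (s * t) * c' + t ^ 2 * b') -
      (s ^ 2 * a + 2 * (s * t) * c + t ^ 2 * b)| ≤ η * (s ^ 2 * a + 2 * (s * t) * c + t ^ 2 * b))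
    (hc : c' ^ 2 ≤ a' * b') :
    |c' / √(a' * b') - c / √(a * b)| ≤ 2 * η := by
  have hsa := Real.sqrt_pos.2 ha
  have hsb := Real.sqrt_pos.2 hb
  have ea := Real.sq_sqrt ha.le
  have eb := Real.sq_sqrt hb.le
  set u := √a
  set w := √b
  have hα : ∀ s t : ℝ, |(s ^ 2 * (a' / a) + 2 * (s * t) * (c' / (u * w)) + t ^ 2 * (b' / b)) -
      (s ^ 2 + 2 * (s * t) * (c / (u * w)) + t ^ 2)| ≤
      η * (s ^ 2 + 2 * (s * t) * (c / (u * w)) + t ^ 2) := by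
    intro s t
    have := h (s / u) (t / w)
    rw [← ea, ← eb] at this ⊢
    convert this using 2
    · field_simp
    · field_simp
  set α := a' / a with hαd
  set β := b' / b with hβd
  set γ := c' / (u * w) with hγd
  set ρ := c / (u * w) with hρd
  have hαpos : 0 < α := div_pos ha' ha
  have hβpos : 0 < β := div_pos hb' hb
  have hα1 : |α - 1| ≤ η := by simpa using hα 1 0
  have hβ1 : |β - 1| ≤ η := by simpa using hα 0 1
  have hp := abs_le.1 (hα 1 1)
  have hm := abs_le.1 (hα 1 (-1))
  have hγ : |γ - ρ| ≤ η := by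
    rw [abs_le]
    constructor <;> nlinarith
  have hr : |√(α * β) - 1| ≤ η := by
    rw [abs_le] at hα1 hβ1 ⊢
    have hη : 0 ≤ η := by linarith
    constructor
    · have : 1 - η ≤ √(α * β) := by
        apply Real.le_sqrt_of_sq_le
        nlinarith
      linarith
    · have : √(α * β) ≤ 1 + η := by
        rw [Real.sqrt_le_left (by linarith)]
        nlinarith
      linarith
  have hsab : √(a * b) = u * w := Real.sqrt_mul ha.le b
  have hab' : a' * b' = (u * w) ^ 2 * (α * β) := by
    rw [mul_pow, ea, eb, hαd, hβd]
    field_simp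
  have hsab' : √(a' * b') = (u * w) * √(α * β) := by
    rw [hab', Real.sqrt_mul (sq_nonneg _), Real.sqrt_sq (by positivity)]
  have hs' : 0 < √(α * β) := Real.sqrt_pos.2 (mul_pos hαpos hβpos)
  have hle1 : |c' / √(a' * b')| ≤ 1 := by
    rw [abs_div, abs_of_nonneg (Real.sqrt_nonneg _), div_le_one (Real.sqrt_pos.2 (by positivity))]
    exact Real.abs_le_sqrt hc
  have hγ' : c' / √(a' * b') * √(α * β) = γ := by
    rw [hsab', hγd]
    field_simp
  rw [hsab]
  calc |c' / √(a' * b') - ρ|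
      = |(γ - ρ) - c' / √(a' * b') * (√(α * β) - 1)| := by
        rw [mul_sub, hγ']; ring_nf
    _ ≤ |γ - ρ| + |c' / √(a' * b') * (√(α * β) - 1)| := abs_sub _ _
    _ ≤ η + 1 * η := by
        rw [abs_mul]
        gcongr
    _ = 2 * η := by ring

theorem sq_partialCov_le (hA : A.PosDef) {S : Finset (Fin p)} {j k : Fin p} (hj : j ∉ S)
    (hk : k ∉ S) : partialCov A S j k ^ 2 ≤ partialCov A S j j * partialCov A S k k := by
  have hpos := partialCov_self_pos hA hk
  have h : 0 ≤ partialCov A S k k ^ 2 * partialCov A S j j +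
      2 * (partialCov A S k k * -partialCov A S j k) * partialCov A S j k +
      (-partialCov A S j k) ^ 2 * partialCov A S k k := by
    rw [← residual_quadratic hA hj hk]
    exact dotProduct_mulVec_nonneg hA _
  have h2 : 0 ≤ partialCov A S k k *
      (partialCov A S j j * partialCov A S k k - partialCov A S j k ^ 2) := by linarith
  linarith [nonneg_of_mul_nonneg_right h2 hpos]

/-- Partial correlations are stable under relative perturbations of the covariance matrix. -/
theorem abs_partialCorr_sub_le (hA : A.PosDef) (hB : B.PosDef) {η : ℝ} (h1 : η ≤ 1)
    (hBA : ∀ v, |v ⬝ᵥ B *ᵥ v - v ⬝ᵥ A *ᵥ v| ≤ η * (v ⬝ᵥ A *ᵥ v))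
    {S : Finset (Fin p)} {j k : Fin p} (hj : j ∉ S) (hk : k ∉ S) :
    |partialCorr B j k S - partialCorr A j k S| ≤ 2 * η :=
  abs_sub_le_of_quadratic (partialCov_self_pos hA hj) (partialCov_self_pos hA hk)
    (partialCov_self_pos hB hj) (partialCov_self_pos hB hk) h1
    (abs_partialCov_quadratic_sub_le hA hB h1 hBA hj hk) (sq_partialCov_le hB hj hk)

end SP

/-! ### Whitening and concentration of the sample covariance. -/

namespace SP

open Matrix
open scoped MatrixOrder

variable {p : ℕ} {A : Matrix (Fin p) (Fin p) ℝ}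

theorem dotProduct_sampleCov {n : ℕ} (x : Sample n p) (v : Fin p → ℝ) :
    v ⬝ᵥ sampleCov x *ᵥ v = (n : ℝ)⁻¹ * ∑ i, (v ⬝ᵥ (x i).ofLp) ^ 2 := by
  have h1 : ∀ i, (v ⬝ᵥ (x i).ofLp) ^ 2 = ∑ a, ∑ b, v a * x i a * (v b * x i b) := fun i => by
    rw [sq, dotProduct, Finset.sum_mul_sum]
  simp only [h1]
  simp only [dotProduct, mulVec, sampleCov, Matrix.of_apply]
  rw [Finset.sum_comm, Finset.mul_sum]
  refine Finset.sum_congr rfl fun a _ => ?_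
  rw [Finset.sum_comm, Finset.mul_sum, Finset.mul_sum]
  refine Finset.sum_congr rfl fun b _ => ?_
  rw [Finset.mul_sum, Finset.mul_sum, Finset.sum_mul, Finset.mul_sum]
  exact Finset.sum_congr rfl fun i _ => by ring

theorem isHermitian_sampleCov {n : ℕ} (x : Sample n p) : (sampleCov x).IsHermitian := by
  ext a b
  simp [sampleCov, mul_comm]

/-- The samples whose covariance matrix is within `η` of the identity matrix. -/
def nearIdentity (n p : ℕ) (η : ℝ) : Set (Sample n p) :=
  {z | ∀ a b, |sampleCov z a b - (1 : Matrix (Fin p) (Fin p) ℝ) a b| < η / p}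

/-- The scale `η / p` of the entries compensates for `(∑ |u_a|)² ≤ p ∑ u_a²`. -/
theorem abs_dotProduct_sampleCov_sub_le {n : ℕ} {η : ℝ} {z : Sample n p}
    (hz : z ∈ nearIdentity n p η) (u : Fin p → ℝ) :
    |u ⬝ᵥ sampleCov z *ᵥ u - u ⬝ᵥ u| ≤ η * (u ⬝ᵥ u) := by
  rcases Nat.eq_zero_or_pos p with rfl | hp
  · simp [dotProduct]
  have hp' : (0 : ℝ) < p := by exact_mod_cast hp
  have hη : 0 < η / p := (abs_nonneg _).trans_lt (hz ⟨0, hp⟩ ⟨0, hp⟩)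
  have h1 : u ⬝ᵥ sampleCov z *ᵥ u - u ⬝ᵥ u =
      ∑ a, ∑ b, u a * (sampleCov z a b - (1 : Matrix (Fin p) (Fin p) ℝ) a b) * u b := by
    have : u ⬝ᵥ u = u ⬝ᵥ (1 : Matrix (Fin p) (Fin p) ℝ) *ᵥ u := by rw [one_mulVec]
    rw [this, ← dotProduct_sub, ← sub_mulVec]
    simp only [dotProduct, mulVec, Finset.mul_sum, Matrix.sub_apply, mul_assoc]
  rw [h1]
  calc |∑ a, ∑ b, u a * (sampleCov z a b - (1 : Matrix (Fin p) (Fin p) ℝ) a b) * u b|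
      ≤ ∑ a, ∑ b, |u a| * (η / p) * |u b| := by
        refine (Finset.abs_sum_le_sum_abs _ _).trans (Finset.sum_le_sum fun a _ => ?_)
        refine (Finset.abs_sum_le_sum_abs _ _).trans (Finset.sum_le_sum fun b _ => ?_)
        rw [abs_mul, abs_mul]
        gcongr
        exact (hz a b).le
    _ = η / p * (∑ a, |u a|) ^ 2 := by
        rw [sq, Finset.sum_mul_sum, Finset.mul_sum]
        refine Finset.sum_congr rfl fun a _ => ?_
        rw [Finset.mul_sum]
        exact Finset.sum_congr rfl fun b _ => by ring
    _ ≤ η / p * (p * (u ⬝ᵥ u)) := by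
        gcongr
        have := sq_sum_le_card_mul_sum_sq (s := (Finset.univ : Finset (Fin p))) (f := fun a => |u a|)
        simpa [dotProduct, sq] using this
    _ = η * (u ⬝ᵥ u) := by field_simp

/-- The standardised sample `A^{-1/2} X`. -/
noncomputable def whiten {n : ℕ} (A : Matrix (Fin p) (Fin p) ℝ) (x : Sample n p) : Sample n p :=
  fun i => toEuclideanCLM (𝕜 := ℝ) (CFC.sqrt A)⁻¹ (x i)

theorem isUnit_det_sqrt (hA : A.PosDef) : IsUnit (CFC.sqrt A).det := by
  have h := congrArg Matrix.det (CFC.sqrt_mul_sqrt_self A hA.posSemidef.nonneg)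
  rw [Matrix.det_mul] at h
  refine isUnit_iff_ne_zero.2 fun h0 => hA.det_pos.ne' ?_
  rw [← h, h0, zero_mul]

/-- Substituting `u = A^{1/2} v` turns closeness to the identity into closeness relative to `A`,
with no condition number involved. -/
theorem abs_dotProduct_sampleCov_sub_le_of_whiten {n : ℕ} (hA : A.PosDef) {η : ℝ}
    {x : Sample n p} (hx : whiten A x ∈ nearIdentity n p η) (v : Fin p → ℝ) :
    |v ⬝ᵥ sampleCov x *ᵥ v - v ⬝ᵥ A *ᵥ v| ≤ η * (v ⬝ᵥ A *ᵥ v) := by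
  have hsymm : (CFC.sqrt A)ᵀ = CFC.sqrt A := by
    have : (CFC.sqrt A).PosSemidef := (CFC.sqrt_nonneg A).posSemidef
    simpa using this.isHermitian.eq
  have h1 : v ⬝ᵥ A *ᵥ v = (CFC.sqrt A *ᵥ v) ⬝ᵥ (CFC.sqrt A *ᵥ v) := by
    conv_lhs => rw [← CFC.sqrt_mul_sqrt_self A hA.posSemidef.nonneg]
    rw [← mulVec_mulVec, dotProduct_mulVec, ← mulVec_transpose, hsymm]
  have h2 : v ⬝ᵥ sampleCov x *ᵥ v =
      (CFC.sqrt A *ᵥ v) ⬝ᵥ sampleCov (whiten A x) *ᵥ (CFC.sqrt A *ᵥ v) := by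
    rw [dotProduct_sampleCov, dotProduct_sampleCov]
    congr 1
    refine Finset.sum_congr rfl fun i _ => ?_
    congr 1
    rw [whiten, ofLp_toEuclideanCLM]
    conv_rhs => rw [← hsymm]
    rw [mulVec_transpose, ← dotProduct_mulVec, hsymm, mulVec_mulVec,
      Matrix.mul_nonsing_inv _ (isUnit_det_sqrt hA), one_mulVec]
  rw [h1, h2]
  exact abs_dotProduct_sampleCov_sub_le hx _

theorem posDef_sampleCov {n : ℕ} (hA : A.PosDef) {η : ℝ} (hη : η < 1)
    {x : Sample n p} (hx : whiten A x ∈ nearIdentity n p η) : (sampleCov x).PosDef := by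
  refine Matrix.PosDef.of_dotProduct_mulVec_pos (isHermitian_sampleCov x) fun v hv => ?_
  have h1 := (abs_le.1 (abs_dotProduct_sampleCov_sub_le_of_whiten hA hx v)).1
  have h2 := dotProduct_mulVec_pos hA hv
  simp only [star_trivial]
  nlinarith

theorem abs_partialCorr_sampleCov_sub_le {n : ℕ} (hA : A.PosDef) {η : ℝ} (hη : η < 1)
    {x : Sample n p} (hx : whiten A x ∈ nearIdentity n p η) {j k : Fin p} {S : Finset (Fin p)}
    (hS : IsTriple j k S) :
    |partialCorr (sampleCov x) j k S - partialCorr A j k S| ≤ 2 * η :=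
  abs_partialCorr_sub_le hA (posDef_sampleCov hA hη hx) hη.le
    (abs_dotProduct_sampleCov_sub_le_of_whiten hA hx) hS.2.1 hS.2.2

/-! ### The law of the standardised sample -/

/-- The law of `n` independent standard Gaussian vectors. -/
noncomputable def stdLaw (n p : ℕ) : Measure (Sample n p) :=
  Measure.pi fun _ => stdGaussian (EuclideanSpace ℝ (Fin p))

/-- The source of uniformity: the image law does not depend on `A`. -/
theorem measurePreserving_whiten (n : ℕ) (hA : A.PosDef) :
    MeasurePreserving (whiten A) (sampleLaw n A) (stdLaw n p) := by
  refine measurePreserving_pi (f := fun _ x => toEuclideanCLM (𝕜 := ℝ) (CFC.sqrt A)⁻¹ x) _ _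
    fun _ => ⟨by fun_prop, ?_⟩
  rw [multivariateGaussian, Measure.map_map (by fun_prop) (by fun_prop)]
  convert Measure.map_id
  ext1 x
  have : toEuclideanCLM (𝕜 := ℝ) (CFC.sqrt A)⁻¹ (toEuclideanCLM (𝕜 := ℝ) (CFC.sqrt A) x) = x := by
    apply WithLp.ofLp_injective
    rw [ofLp_toEuclideanCLM, ofLp_toEuclideanCLM, mulVec_mulVec,
      Matrix.nonsing_inv_mul _ (isUnit_det_sqrt hA), one_mulVec]
  simpa using this

theorem measurable_sampleCov_apply {n : ℕ} (a b : Fin p) :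
    Measurable fun z : Sample n p => sampleCov z a b := by
  simp only [sampleCov, Matrix.of_apply]
  fun_prop

theorem measurableSet_nearIdentity (n p : ℕ) (η : ℝ) : MeasurableSet (nearIdentity n p η) := by
  have : nearIdentity n p η = ⋂ a, ⋂ b,
      {z | |sampleCov z a b - (1 : Matrix (Fin p) (Fin p) ℝ) a b| < η / p} := by
    ext z; simp [nearIdentity]
  rw [this]
  refine MeasurableSet.iInter fun a => MeasurableSet.iInter fun b => ?_
  exact measurableSet_lt ((measurable_sampleCov_apply a b).sub_const _).abs measurable_const

theorem memLp_coord (a : Fin p) (q : ENNReal) (hq : q ≠ ⊤) :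
    MemLp (fun x : EuclideanSpace ℝ (Fin p) => x a) q (stdGaussian _) :=
  (EuclideanSpace.proj (𝕜 := ℝ) a).comp_memLp' (IsGaussian.memLp_id _ q hq)

theorem memLp_mul_coord (a b : Fin p) :
    MemLp (fun x : EuclideanSpace ℝ (Fin p) => x a * x b) 2 (stdGaussian _) := by
  have : ENNReal.HolderTriple 4 4 2 := ⟨by
    rw [← two_mul, show (4 : ENNReal) = 2 * 2 by norm_num, ENNReal.mul_inv (by simp) (by simp),
      ← mul_assoc, ENNReal.mul_inv_cancel (by simp) (by simp), one_mul]⟩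
  exact (memLp_coord b 4 (by simp)).mul (memLp_coord a 4 (by simp))

theorem integral_mul_coord (a b : Fin p) :
    ∫ x : EuclideanSpace ℝ (Fin p), x a * x b ∂(stdGaussian _) =
      (1 : Matrix (Fin p) (Fin p) ℝ) a b := by
  have h1 := covariance_eval_multivariateGaussian (μ := (0 : EuclideanSpace ℝ (Fin p)))
    (Matrix.PosSemidef.one (n := Fin p) (R := ℝ)) a b
  have h2 : ∫ x : EuclideanSpace ℝ (Fin p), x a ∂(stdGaussian _) = 0 :=
    integral_strongDual_stdGaussian (EuclideanSpace.proj (𝕜 := ℝ) a)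
  rw [multivariateGaussian_zero_one, covariance_eq_sub (memLp_coord a 2 (by simp))
    (memLp_coord b 2 (by simp)), h2, zero_mul, sub_zero] at h1
  exact h1

instance (n p : ℕ) : IsProbabilityMeasure (stdLaw n p) := by
  unfold stdLaw; infer_instance

/-- Chebyshev's inequality for an average of `n` independent products of coordinates. -/
theorem stdLaw_sampleCov_le {n : ℕ} (hn : 0 < n) (a b : Fin p) {c : ℝ} (hc : 0 < c) :
    stdLaw n p {z | c ≤ |sampleCov z a b - (1 : Matrix (Fin p) (Fin p) ℝ) a b|} ≤
      ENNReal.ofReal (Var[fun x : EuclideanSpace ℝ (Fin p) => x a * x b; stdGaussian _] /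
        (n * c ^ 2)) := by
  have hn' : (n : ℝ) ≠ 0 := by exact_mod_cast hn.ne'
  set f : EuclideanSpace ℝ (Fin p) → ℝ := fun x => x a * x b with hf
  have hfm : MemLp f 2 (stdGaussian _) := memLp_mul_coord a b
  have hmem : ∀ i : Fin n, MemLp (fun z : Sample n p => f (z i)) 2 (stdLaw n p) := fun i =>
    hfm.comp_measurePreserving (measurePreserving_eval _ i)
  have hcov : (fun z : Sample n p => sampleCov z a b) =
      fun z => (n : ℝ)⁻¹ * (∑ i, fun z : Sample n p => f (z i)) z := by
    funext z
    simp [sampleCov, hf]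
  have hvar : Var[fun z : Sample n p => sampleCov z a b; stdLaw n p] =
      Var[f; stdGaussian _] / n := by
    rw [hcov, variance_const_mul, stdLaw, variance_sum_pi fun _ => hfm]
    simp
    field_simp
  have hint : ∫ z : Sample n p, sampleCov z a b ∂(stdLaw n p) =
      (1 : Matrix (Fin p) (Fin p) ℝ) a b := by
    rw [hcov, integral_const_mul]
    simp only [Finset.sum_apply]
    rw [integral_finsetSum _ fun i _ => (hmem i).integrable (by norm_num)]
    have : ∀ i : Fin n, ∫ z : Sample n p, f (z i) ∂(stdLaw n p) =
        (1 : Matrix (Fin p) (Fin p) ℝ) a b := fun i => by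
      rw [stdLaw, integral_comp_eval hfm.1, integral_mul_coord]
    simp [this, hn']
  have hmemc : MemLp (fun z : Sample n p => sampleCov z a b) 2 (stdLaw n p) := by
    rw [hcov]
    exact (memLp_finsetSum' _ fun i _ => hmem i).const_mul _
  have := meas_ge_le_variance_div_sq hmemc hc
  rw [hvar, hint, div_div] at this
  exact this

/-- The probability that the standardised sample covariance matrix is not within `n^{-1/4}` of the
identity matrix tends to `0`. -/
theorem tendsto_stdLaw_compl_nearIdentity (p : ℕ) :
    Tendsto (fun n : ℕ => stdLaw n p (nearIdentity n p (√(√n))⁻¹)ᶜ) atTop (𝓝 0) := by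
  set V : Fin p → Fin p → ℝ := fun a b =>
    Var[fun x : EuclideanSpace ℝ (Fin p) => x a * x b; stdGaussian _] with hV
  -- Chebyshev at distance `n^{-1/4} / p` bounds each entry by `V p² n^{-1/2}`; a union bound runs
  -- over the entries.
  have hlim : Tendsto (fun n : ℕ => ∑ a, ∑ b, ENNReal.ofReal (V a b * p ^ 2 * (√n)⁻¹))
      atTop (𝓝 0) := by
    rw [show (0 : ENNReal) = ∑ _a : Fin p, ∑ _b : Fin p, 0 by simp]
    refine tendsto_finsetSum _ fun a _ => tendsto_finsetSum _ fun b _ => ?_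
    rw [← ENNReal.ofReal_zero]
    refine ENNReal.tendsto_ofReal ?_
    rw [← mul_zero (V a b * p ^ 2)]
    exact (tendsto_inv_atTop_zero.comp
      (Real.tendsto_sqrt_atTop.comp tendsto_natCast_atTop_atTop)).const_mul _
  refine tendsto_of_tendsto_of_tendsto_of_le_of_le' tendsto_const_nhds hlim
    (Eventually.of_forall fun _ => zero_le) ?_
  filter_upwards [eventually_gt_atTop 0] with n hn
  have hn' : (0 : ℝ) < n := by exact_mod_cast hn
  have hsub : (nearIdentity n p (√(√n))⁻¹)ᶜ ⊆ ⋃ a, ⋃ b,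
      {z | (√(√n))⁻¹ / p ≤ |sampleCov z a b - (1 : Matrix (Fin p) (Fin p) ℝ) a b|} := by
    intro z hz
    simpa [nearIdentity] using hz
  refine (measure_mono hsub).trans ((measure_iUnion_fintype_le _ _).trans
    (Finset.sum_le_sum fun a _ => (measure_iUnion_fintype_le _ _).trans
      (Finset.sum_le_sum fun b _ => ?_)))
  have hp : (0 : ℝ) < p := by exact_mod_cast a.pos
  have hs : 0 < √(n : ℝ) := Real.sqrt_pos.2 hn'
  have hss : 0 < √√(n : ℝ) := Real.sqrt_pos.2 hs
  refine (stdLaw_sampleCov_le hn a b (by positivity)).trans (le_of_eq ?_)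
  congr 1
  have h1 : √√(n : ℝ) ^ 2 = √(n : ℝ) := Real.sq_sqrt hs.le
  have h2 : √(n : ℝ) ^ 2 = n := Real.sq_sqrt hn'.le
  have h3 : (n : ℝ) * ((√√(n : ℝ))⁻¹ / p) ^ 2 = √(n : ℝ) / p ^ 2 := by
    rw [div_pow, inv_pow, h1]
    nth_rewrite 1 [← h2]
    field_simp
  rw [h3]
  field_simp
  rfl

end SP

/-! ### The regularised tests and their consistency. -/

namespace SP

variable {p : ℕ}

/-- The smallest number of edges amongst the DAGs that `R` associates to the permutations. -/
noncomputable def minNumEdges (R : Fin p → Fin p → Finset (Fin p) → Prop) : ℕ :=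
  ⨅ π, (permDAG R π).numEdges

theorem exists_numEdges_eq_minNumEdges (R : Fin p → Fin p → Finset (Fin p) → Prop) :
    ∃ π, (permDAG R π).numEdges = minNumEdges R :=
  Nat.sInf_mem (Set.range_nonempty _)

theorem minNumEdges_le (R : Fin p → Fin p → Finset (Fin p) → Prop) (π : Equiv.Perm (Fin p)) :
    minNumEdges R ≤ (permDAG R π).numEdges :=
  Nat.sInf_le ⟨π, rfl⟩

theorem IsMarkov.minNumEdges_le {G : DAG p} {R : Fin p → Fin p → Finset (Fin p) → Prop}
    (h : IsMarkov G R) : minNumEdges R ≤ G.numEdges := by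
  obtain ⟨π, hπ⟩ := G.exists_topological
  exact (SP.minNumEdges_le R π).trans (DAG.numEdges_le_of_adj_imp (h.adj_of_permDAG_adj hπ))

/-- `R` is a permutation Markov subset of `Q`. -/
def IsAdmissible (Q R : Fin p → Fin p → Finset (Fin p) → Prop) : Prop :=
  IsPermMarkov R ∧ ∀ j k S, IsTriple j k S → R j k S → Q j k S

/-- Amongst the permutation Markov subsets of `Q`, the set `R` leads to a sparsest DAG. -/
def IsSparsest (Q R : Fin p → Fin p → Finset (Fin p) → Prop) : Prop :=
  IsAdmissible Q R ∧ ∀ R', IsAdmissible Q R' → minNumEdges R ≤ minNumEdges R'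

theorem IsAdmissible.exists_isSparsest {Q R : Fin p → Fin p → Finset (Fin p) → Prop}
    (h : IsAdmissible Q R) : ∃ R', IsSparsest Q R' := by
  classical
  have hne : ∃ m, ∃ R', IsAdmissible Q R' ∧ minNumEdges R' = m := ⟨_, R, h, rfl⟩
  obtain ⟨R', hR', hm⟩ := Nat.find_spec hne
  exact ⟨R', hR', fun R'' hR'' => hm ▸ Nat.find_min' hne ⟨R'', hR'', rfl⟩⟩

open Classical in
/-- The relations `R` if they are permutation Markov, otherwise a permutation Markov subset of `Q`
which leads to a sparsest DAG. -/
noncomputable def regularize (R Q : Fin p → Fin p → Finset (Fin p) → Prop) :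
    Fin p → Fin p → Finset (Fin p) → Prop :=
  if IsPermMarkov R then R else Classical.epsilon (IsSparsest Q)

/-- Soundness of the regularisation: if `R` and `Q` lie between the conditional independence
relations `R₀` and relations for which `G` is a sparsest Markov representation, then the SP
algorithm recovers the Markov equivalence class of `G`. -/
theorem spOutput_regularize {R₀ R Q Q' : Fin p → Fin p → Finset (Fin p) → Prop} {G : DAG p}
    (h₀ : IsPermMarkov R₀) (hG₀ : IsMarkov G R₀)
    (hR : ∀ j k S, IsTriple j k S → R₀ j k S → R j k S)
    (hRQ : ∀ j k S, IsTriple j k S → R j k S → Q j k S)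
    (hQ : ∀ j k S, IsTriple j k S → Q j k S → Q' j k S) (hG : IsSMR G Q') :
    spOutput (regularize R Q) = markovClass G := by
  by_cases hRM : IsPermMarkov R
  · rw [regularize, if_pos hRM]
    refine hRM.spOutput_eq (fun j k S hS h => hQ j k S hS (hRQ j k S hS h)) hG ?_
    obtain ⟨π, hπ⟩ := exists_numEdges_eq_minNumEdges R
    exact ⟨π, hπ.trans_le (hG₀.mono hR).minNumEdges_le⟩
  · rw [regularize, if_neg hRM]
    have hadm : IsAdmissible Q R₀ := ⟨h₀, fun j k S hS h => hRQ j k S hS (hR j k S hS h)⟩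
    obtain ⟨⟨h1, h2⟩, h3⟩ := Classical.epsilon_spec hadm.exists_isSparsest
    refine h1.spOutput_eq (fun j k S hS h => hQ j k S hS (h2 j k S hS h)) hG ?_
    obtain ⟨π, hπ⟩ := exists_numEdges_eq_minNumEdges (Classical.epsilon (IsSparsest Q))
    exact ⟨π, hπ.trans_le ((h3 R₀ hadm).trans hG₀.minNumEdges_le)⟩

/-- The relations `|r j k S| ≤ c`. -/
def threshold (c : ℝ) (r : Fin p → Fin p → Finset (Fin p) → ℝ) (j k : Fin p)
    (S : Finset (Fin p)) : Prop :=
  |r j k S| ≤ c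

/-- The error bound `n^{-1/4}` for the sample covariance matrix. -/
noncomputable def rate (n : ℕ) : ℝ := (√(√n))⁻¹

theorem tendsto_rate : Tendsto rate atTop (𝓝 0) :=
  tendsto_inv_atTop_zero.comp (Real.tendsto_sqrt_atTop.comp
    (Real.tendsto_sqrt_atTop.comp tendsto_natCast_atTop_atTop))

open Classical in
/-- Thresholding of the sample partial correlations, regularised so that the SP algorithm stays
reliable near singular covariance matrices. Without the regularisation uniformity fails: if `X_1`
and `X_2` are nearly collinear, then `ρ_{1,3|2}` and `ρ_{2,3|1}` may both fall below any given
threshold although `X_3` depends strongly on `(X_1, X_2)`, and the DAGs of the SP algorithm need not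
be Markov. At each fixed nondegenerate covariance matrix, the regularisation changes nothing with
probability tending to one. -/
noncomputable def regularizedTest (lam : ℝ) (n : ℕ) : TestFamily n p := fun j k S x =>
  !decide (regularize (threshold (2 * rate n) (partialCorr (sampleCov x)))
    (threshold (lam / 2) (partialCorr (sampleCov x))) j k S)

theorem inferredCI_regularizedTest (lam : ℝ) {n : ℕ} (x : Sample n p) :
    inferredCI (regularizedTest lam n) x =
      regularize (threshold (2 * rate n) (partialCorr (sampleCov x)))
        (threshold (lam / 2) (partialCorr (sampleCov x))) := by
  funext j k S
  simp [inferredCI, regularizedTest]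

theorem measurable_threshold (c : ℝ) :
    Measurable (threshold c : (Fin p → Fin p → Finset (Fin p) → ℝ) → _) := by
  refine measurable_pi_lambda _ fun j => measurable_pi_lambda _ fun k =>
    measurable_pi_lambda _ fun S => ?_
  refine measurableSet_setOfPred.1 (measurableSet_le ?_ measurable_const)
  fun_prop

theorem isPartialCorrTest_regularizedTest (lam : ℝ) (n : ℕ) :
    IsPartialCorrTest (p := p) (regularizedTest lam n) := by
  classical
  intro j k S
  let g : (Fin p → Fin p → Finset (Fin p) → Prop) × (Fin p → Fin p → Finset (Fin p) → Prop) →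
    Bool := fun R => !decide (regularize R.1 R.2 j k S)
  refine ⟨fun r => g (threshold (2 * rate n) r, threshold (lam / 2) r), ?_, fun x => ?_⟩
  -- Only finitely many sets of relations exist, so the regularisation, despite its arbitrary
  -- choice, is measurable.
  · exact (measurable_of_finite g).comp
      ((measurable_threshold _).prodMk (measurable_threshold _))
  · simp [g, regularizedTest]

variable {A : Matrix (Fin p) (Fin p) ℝ}

theorem isPermMarkov_omega_zero (hA : A.PosDef) : IsPermMarkov (Omega A 0) :=
  isPermMarkov_of_iff hA fun j k S _ => by simp [Omega]

/-- With error `2 * rate n`, the condition `4 * rate n ≤ lam` gives both `2 * rate n ≤ lam / 2` and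
`lam / 2 + 2 * rate n ≤ lam`. -/
theorem spOutput_regularizedTest (hA : A.PosDef) {lam : ℝ} {G : DAG p}
    (hG : IsMarkov G (Omega A 0)) (hGA : IsStrongSMR lam G A) {n : ℕ} (hn : rate n < 1)
    (hn' : 4 * rate n ≤ lam) {x : Sample n p} (hx : whiten A x ∈ nearIdentity n p (rate n)) :
    spOutput (inferredCI (regularizedTest lam n) x) = markovClass G := by
  rw [inferredCI_regularizedTest]
  have hclose := fun j k S (hS : IsTriple j k S) =>
    abs_le.1 (abs_partialCorr_sampleCov_sub_le hA hn hx hS)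
  refine spOutput_regularize (isPermMarkov_omega_zero hA) hG (fun j k S hS h => ?_)
    (fun j k S hS h => ?_) (fun j k S hS h => ?_) hGA
  · have h0 : partialCorr A j k S = 0 := by simpa [Omega] using h
    have := hclose j k S hS
    rw [h0, sub_zero] at this
    exact abs_le.2 this
  · exact le_trans (b := 2 * rate n) h (by linarith)
  · have h1 := abs_le.1 h
    have h2 := hclose j k S hS
    exact abs_le.2 ⟨by linarith, by linarith⟩

/-- The gap `4 * rate n` exceeds threshold plus error, so thresholding recovers the true relations;
these are permutation Markov and `regularize` leaves them alone. -/
theorem regularizedTest_eq_false_iff (hA : A.PosDef) {lam : ℝ} {n : ℕ} (hn : rate n < 1)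
    (hn' : ∀ j k S, partialCorr A j k S ≠ 0 → 4 * rate n < |partialCorr A j k S|)
    {x : Sample n p} (hx : whiten A x ∈ nearIdentity n p (rate n)) {j k : Fin p}
    {S : Finset (Fin p)} (hS : IsTriple j k S) :
    regularizedTest lam n j k S x = false ↔ partialCorr A j k S = 0 := by
  have hiff : ∀ j k S, IsTriple j k S →
      (threshold (2 * rate n) (partialCorr (sampleCov x)) j k S ↔ partialCorr A j k S = 0) := by
    intro j k S hS
    have h1 := abs_partialCorr_sampleCov_sub_le hA hn hx hS
    constructor
    · intro h
      by_contra hne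
      have h2 := hn' j k S hne
      have h3 : |partialCorr (sampleCov x) j k S| ≤ 2 * rate n := h
      have h4 := abs_sub_abs_le_abs_sub (partialCorr A j k S) (partialCorr (sampleCov x) j k S)
      rw [abs_sub_comm] at h4
      linarith
    · intro h
      rwa [h, sub_zero] at h1
  have h := congrFun (congrFun (congrFun (inferredCI_regularizedTest lam x) j) k) S
  rw [regularize, if_pos (isPermMarkov_of_iff hA hiff)] at h
  rw [← hiff j k S hS, ← h]
  rfl

/-- The probability that the standardised sample covariance matrix is far from the identity. -/
theorem sampleLaw_le_of_imp (hA : A.PosDef) {n : ℕ} {s : Set (Sample n p)}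
    (hs : ∀ x, whiten A x ∈ nearIdentity n p (rate n) → x ∉ s) :
    sampleLaw n A s ≤ stdLaw n p (nearIdentity n p (rate n))ᶜ := by
  -- Only the good event needs measurability; `s` is handled by monotonicity of the outer measure.
  rw [← (measurePreserving_whiten n hA).measure_preimage
    (measurableSet_nearIdentity n p _).compl.nullMeasurableSet]
  exact measure_mono fun x hx hx' => hs x hx' hx

theorem isConsistentTest_regularizedTest (lam : ℝ) :
    IsConsistentTest (p := p) (regularizedTest lam) := by
  intro j k S hS A hA
  have hsmall : ∀ᶠ n in atTop, rate n < 1 ∧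
      ∀ j k S, partialCorr A j k S ≠ 0 → 4 * rate n < |partialCorr A j k S| := by
    refine (tendsto_rate.eventually_lt_const one_pos).and ?_
    -- There are finitely many triples, so one sample size serves all of them.
    simp only [eventually_all]
    intro j k S hne
    refine (tendsto_rate.const_mul 4).eventually_lt_const ?_
    rw [mul_zero]
    exact abs_pos.2 hne
  have key : ∀ b : Bool, (b = false ↔ partialCorr A j k S ≠ 0) →
      Tendsto (fun n => sampleLaw n A {x | regularizedTest lam n j k S x = b}) atTop (𝓝 0) := by
    intro b hb
    refine tendsto_of_tendsto_of_tendsto_of_le_of_le' tendsto_const_nhds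
      (tendsto_stdLaw_compl_nearIdentity p) (Eventually.of_forall fun _ => zero_le) ?_
    filter_upwards [hsmall] with n hn
    refine sampleLaw_le_of_imp hA fun x hx hxb => ?_
    have := regularizedTest_eq_false_iff (lam := lam) hA hn.1 hn.2 hx hS
    rw [show regularizedTest lam n j k S x = b from hxb] at this
    tauto
  exact ⟨fun h => key true (by simp [h]), fun h => key false (by simp [h])⟩

end SP

theorem mainTheorem3 (p : ℕ) (lam : ℝ) (hlam : 0 < lam) :
    ∃ φ : (n : ℕ) → SP.TestFamily n p,
      (∀ n, SP.IsPartialCorrTest (φ n)) ∧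
      SP.IsConsistentTest φ ∧
      Tendsto
        (fun n => ⨆ (G : SP.DAG p) (A : Matrix (Fin p) (Fin p) ℝ) (_ : A.PosDef)
            (_ : SP.IsMarkov G (SP.Omega A 0)) (_ : SP.IsStrongSMR lam G A),
          SP.sampleLaw n A {x | SP.spOutput (SP.inferredCI (φ n) x) ≠ SP.markovClass G})
        atTop (𝓝 0) := by
  refine ⟨SP.regularizedTest lam, SP.isPartialCorrTest_regularizedTest lam,
    SP.isConsistentTest_regularizedTest lam, ?_⟩
  refine tendsto_of_tendsto_of_tendsto_of_le_of_le' tendsto_const_nhds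
    (SP.tendsto_stdLaw_compl_nearIdentity p) (Eventually.of_forall fun _ => zero_le) ?_
  have h4 : Tendsto (fun n => 4 * SP.rate n) atTop (𝓝 0) := by
    simpa using SP.tendsto_rate.const_mul 4
  -- Neither the threshold on `n` nor the bounding probability involves `G` or `A`, so the bound
  -- passes to the supremum.
  filter_upwards [SP.tendsto_rate.eventually_lt_const one_pos, h4.eventually_le_const hlam]
    with n hn hn'
  refine iSup_le fun G => iSup_le fun A => iSup_le fun hA => iSup_le fun hG => iSup_le fun hGA => ?_
  exact SP.sampleLaw_le_of_imp hA fun x hx hne =>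
    hne (SP.spOutput_regularizedTest hA hG hGA hn hn' hx)
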